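/- **Setting.** Let $(M,d)$ be a proper metric space on which a discrete group $\Gamma$ acts by homeomorphisms (not necessarily faithfully), and let $\Lambda\subset M$ be a non-empty compact $\Gamma$-invariant subset, no point of which is isolated in $M$. Write $B_r(x)$ for open balls and $N_r(\Lambda)$ for the open $r$-neighborhood of $\Lambda$. An *expansion datum* $\mathcal D=(\mathcal I,\mathcal U,\Sigma,\delta,L,\lambda)$ consists of a finite index set $\mathcal I$, a cover $\mathcal U=\{U_\alpha\}_{\alpha\in\mathcal I}$ of $\Lambda$ by (possibly empty) open subsets of $M$, elements $s_\alpha\in\Gamma$ $(\alpha\in\mathcal I)$ whose set $\Sigma=\{s_\alpha\}$ is a symmetric generating set of $\Gamma$, and real numbers $L\ge\lambda>1$ and $\delta>0$, such that every ball $B_\delta(x)$, $x\in\Lambda$, lies in some $U_\alpha$, and such that for every $\alpha$ the map $f=s_\alpha^{-1}$ is $L$-Lipschitz on $N_\delta(\Lambda)$, satisfies $d(f(x),f(y))\ge\lambda d(x,y)$ for $x,y\in U_\alpha$, and satisfies $B_{\lambda\eta}(f(x))\subset f(B_\eta(x))$ whenever $0<\eta\le\delta$ and $B_\eta(x)\subset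 U_\alpha$. For $0<\eta\le\delta$ and $x\in\Lambda$, a *$(\mathcal D,\eta)$-code* for $x$ is a sequence $\alpha:\{0,1,2,\dots\}\to\mathcal I$ such that the points $p_0=x$, $p_{i+1}=s_{\alpha(i)}^{-1}p_i$ satisfy $B_\eta(p_i)\subset U_{\alpha(i)}$ for all $i\ge1$. Its *ray* is the sequence $c^\alpha_i=s_{\alpha(0)}s_{\alpha(1)}\cdots s_{\alpha(i)}$ in $\Gamma$. The set of these rays is $\mathrm{Ray}_x(\mathcal D,\eta)$. For $N\ge 0$, two rays in $\mathrm{Ray}_x(\mathcal D,\eta)$ are *$(\mathcal D,\eta;N)$-equivalent* if they are equivalent under the equivalence relation on $\mathrm{Ray}_x(\mathcal D,\eta)$ generated by the relation $\approx$, where $c\approx c'$ means that there are infinite sets $P,Q\subset\{0,1,2,\dots\}$ for which $c(P)$ and $c'(Q)$ are within Hausdorff distance $N$ in the word metric of $\Sigma$. A *refinement* of $\mathcal D_0=(\mathcal I_0,\mathcal U_0,\Sigma_0,\delta_0,L_0,\lambda_0)$ is an expansion datum $\mathcal D=(\mathcal I,\mathcal U,\Sigma,\delta,L,\lambda)$ of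 the same action with $\mathcal I_0\subset\mathcal I$, $U_{0,\alpha}\subset U_\alpha$ and $s_{0,\alpha}=s_\alpha$ for $\alpha\in\mathcal I_0$, $\delta<\delta_0$, $L_0\le L$ and $\lambda\le\lambda_0$. The action is *meandering-hyperbolic with datum $(\mathcal D_0\prec\mathcal D;N)$* if $\mathcal D$ is a refinement of the expansion datum $\mathcal D_0$, $N\ge1$ is an integer, and for every $x\in\Lambda$ all rays in $\mathrm{Ray}_x(\mathcal D_0,\delta_0)$ are $(\mathcal D,\delta;N)$-equivalent. The group $\Gamma$ is *hyperbolic* if its Cayley graph with respect to some finite generating set is Gromov hyperbolic; it is *elementary* if it has a cyclic subgroup of finite index. The Gromov boundary $\partial_\infty\Gamma$ is the visual boundary of the Cayley graph of $\Gamma$ with respect to a finite generating set (any such set may be used), with its usual topology and the action of $\Gamma$ induced by left multiplication. **Theorem.** Let $\Gamma$ be a non-elementary hyperbolic group, and let its action on $M$ with invariant set $\Lambda$ be meandering-hyperbolic with datum $(\mathcal D_0\prec\mathcal D;N)$. Then for every $x\in\Lambda$ all rays in $\mathrm{Ray}_x(\mathcal D_0,\delta_0)$ are quasigeodesic rays that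 represent one and the same point $\pi(x)\in\partial_\infty\Gamma$, so that there is a unique map $\pi:\Lambda\to\partial_\infty\Gamma$ (the *coding map*) whose value at $x$ is represented by all these rays, and the following hold. 1. The coding map $\pi:\Lambda\to\partial_\infty\Gamma$ is $\Gamma$-equivariant, continuous and surjective. 2. For each minimal non-empty closed $\Gamma$-invariant subset $\Lambda_\mu\subset\Lambda$, the restriction $\pi|_{\Lambda_\mu}:\Lambda_\mu\to\partial_\infty\Gamma$ is surjective and quasi-open: the image of every subset of $\Lambda_\mu$ with non-empty interior in $\Lambda_\mu$ has non-empty interior in $\partial_\infty\Gamma$. 3. Every such $\Lambda_\mu$ is perfect: it has at least two points and no isolated points. -/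

import Mathlib

open Set Filter Topology

namespace MeanderingHyperbolic

/-! ### Coarse geometry of graphs

A graph carries its path metric `G.edist`.  Geodesics are recorded by the vertices that they visit
at integer times. -/

section Graph

variable {V : Type*}

/-- `c 0, …, c n` are the consecutive vertices of a geodesic segment of length `n`. -/
def IsGeodesicSegment (G : SimpleGraph V) (n : ℕ) (c : ℕ → V) : Prop :=
  ∀ i m : ℕ, i + m ≤ n → G.edist (c i) (c (i + m)) = m

/-- `c 0, c 1, …` are the consecutive vertices of a geodesic ray. -/
def IsGeodesicRay (G : SimpleGraph V) (c : ℕ → V) : Prop :=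
  ∀ i m : ℕ, G.edist (c i) (c (i + m)) = m

/-- Every geodesic triangle, with sides `a` from `x` to `y`, `b` from `y` to `z` and `c` from `z`
to `x`, is `δ`-thin.  Only the side `a` is mentioned in the conclusion: the other two are covered
by rotating the triangle. -/
def HasThinTriangles (G : SimpleGraph V) (δ : ℕ) : Prop :=
  ∀ (l m n : ℕ) (a b c : ℕ → V),
    IsGeodesicSegment G l a → IsGeodesicSegment G m b → IsGeodesicSegment G n c →
    a l = b 0 → b m = c 0 → c n = a 0 →
    ∀ i ≤ l, (∃ j ≤ m, G.edist (a i) (b j) ≤ δ) ∨ (∃ j ≤ n, G.edist (a i) (c j) ≤ δ)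

/-- The sets of vertices `A` and `B` are within Hausdorff distance `N` from each other (distances
between vertices are integers, so the infima in the Hausdorff distance are attained). -/
def HausdorffClose (G : SimpleGraph V) (N : ℕ) (A B : Set V) : Prop :=
  (∀ a ∈ A, ∃ b ∈ B, G.edist a b ≤ N) ∧ (∀ b ∈ B, ∃ a ∈ A, G.edist a b ≤ N)

/-- `c` is an `(A, C)`-quasigeodesic ray for some `A ≥ 1`, `C ≥ 0`. -/
def IsQuasigeodesicRay (G : SimpleGraph V) (c : ℕ → V) : Prop :=
  ∃ A C : ℝ, 1 ≤ A ∧ 0 ≤ C ∧ ∀ i j : ℕ,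
    1 / A * |(i : ℝ) - j| - C ≤ (G.dist (c i) (c j) : ℝ) ∧
    (G.dist (c i) (c j) : ℝ) ≤ A * |(i : ℝ) - j| + C

theorem HausdorffClose.refl (G : SimpleGraph V) (A : Set V) : HausdorffClose G 0 A A :=
  ⟨fun a ha => ⟨a, ha, by simp⟩, fun a ha => ⟨a, ha, by simp⟩⟩

theorem HausdorffClose.symm {G : SimpleGraph V} {N : ℕ} {A B : Set V}
    (h : HausdorffClose G N A B) : HausdorffClose G N B A :=
  ⟨fun b hb => (h.2 b hb).imp fun a ha => ⟨ha.1, by rw [G.edist_comm]; exact ha.2⟩,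
    fun a ha => (h.1 a ha).imp fun b hb => ⟨hb.1, by rw [G.edist_comm]; exact hb.2⟩⟩

theorem HausdorffClose.trans {G : SimpleGraph V} {N N' : ℕ} {A B C : Set V}
    (h : HausdorffClose G N A B) (h' : HausdorffClose G N' B C) :
    HausdorffClose G (N + N') A C := by
  constructor
  · intro a ha
    obtain ⟨b, hb, hab⟩ := h.1 a ha
    obtain ⟨c, hc, hbc⟩ := h'.1 b hb
    exact ⟨c, hc, G.edist_triangle.trans (by push_cast; exact add_le_add hab hbc)⟩
  · intro c hc
    obtain ⟨b, hb, hbc⟩ := h'.2 c hc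
    obtain ⟨a, ha, hab⟩ := h.2 b hb
    exact ⟨a, ha, G.edist_triangle.trans (by push_cast; exact add_le_add hab hbc)⟩

end Graph

/-! ### Hyperbolic groups and the Gromov boundary -/

section Group

variable {Γ : Type*} [Group Γ]

/-- The Cayley graph of `Γ` with respect to `S`, with edges joining `g` to `g * s` for `s ∈ S`. -/
abbrev cayley (S : Set Γ) : SimpleGraph Γ := SimpleGraph.mulCayley S

variable (Γ) in
/-- Word-hyperbolic group: the Cayley graph with respect to some finite generating set is
hyperbolic. -/
def IsHyperbolicGroup : Prop :=
  ∃ S : Set Γ, S.Finite ∧ Subgroup.closure S = ⊤ ∧ ∃ δ : ℕ, HasThinTriangles (cayley S) δ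

variable (Γ) in
/-- Elementary group: some cyclic subgroup has finite index. -/
def IsElementary : Prop :=
  ∃ H : Subgroup Γ, IsCyclic H ∧ H.FiniteIndex

theorem edist_le_mul_left (S : Set Γ) (g u v : Γ) :
    (cayley S).edist (g * u) (g * v) ≤ (cayley S).edist u v := by
  by_cases h : (cayley S).edist u v = ⊤
  · simp [h]
  · obtain ⟨p, hp⟩ := (cayley S).exists_walk_of_edist_ne_top h
    let f : cayley S →g cayley S := ⟨fun x => g * x, fun {a b} hab => by
      simpa using hab⟩
    rw [← hp, ← SimpleGraph.Walk.length_map f p]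
    exact SimpleGraph.edist_le _

/-- Left multiplication is an isometry of the Cayley graph. -/
theorem edist_mul_left (S : Set Γ) (g u v : Γ) :
    (cayley S).edist (g * u) (g * v) = (cayley S).edist u v := by
  refine le_antisymm (edist_le_mul_left S g u v) ?_
  simpa using edist_le_mul_left S g⁻¹ (g * u) (g * v)

/-- Geodesic rays of the Cayley graph. -/
def GeodesicRay (S : Set Γ) : Type _ := {c : ℕ → Γ // IsGeodesicRay (cayley S) c}

/-- Two geodesic rays are asymptotic if their images are at finite Hausdorff distance. -/
instance asymptotic (S : Set Γ) : Setoid (GeodesicRay S) where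
  r c c' := ∃ N : ℕ, HausdorffClose (cayley S) N (range c.1) (range c'.1)
  iseqv :=
    { refl := fun _ => ⟨0, HausdorffClose.refl _ _⟩
      symm := fun ⟨N, h⟩ => ⟨N, h.symm⟩
      trans := fun ⟨N, h⟩ ⟨N', h'⟩ => ⟨N + N', h.trans h'⟩ }

/-- The Gromov boundary of `Γ`, as the visual boundary of the Cayley graph with respect to `S`:
the set of geodesic rays up to asymptoticity. -/
def GromovBoundary (S : Set Γ) : Type _ := Quotient (asymptotic S)

/-- The boundary point represented by a geodesic ray. -/
def GeodesicRay.endpoint {S : Set Γ} (c : GeodesicRay S) : GromovBoundary S :=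
  Quotient.mk (asymptotic S) c

/-- The left translate of a geodesic ray. -/
def GeodesicRay.translate {S : Set Γ} (g : Γ) (c : GeodesicRay S) : GeodesicRay S :=
  ⟨fun i => g * c.1 i, fun i m => by rw [edist_mul_left]; exact c.2 i m⟩

/-- `Γ` acts on its boundary by left translation of rays. -/
instance (S : Set Γ) : MulAction Γ (GromovBoundary S) where
  smul g := Quotient.map (GeodesicRay.translate g) (by
    rintro c c' ⟨N, h₁, h₂⟩
    refine ⟨N, ?_, ?_⟩
    · rintro _ ⟨i, rfl⟩
      obtain ⟨_, ⟨j, rfl⟩, hj⟩ := h₁ _ ⟨i, rfl⟩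
      exact ⟨_, ⟨j, rfl⟩, (edist_mul_left S g _ _).trans_le hj⟩
    · rintro _ ⟨i, rfl⟩
      obtain ⟨_, ⟨j, rfl⟩, hj⟩ := h₂ _ ⟨i, rfl⟩
      exact ⟨_, ⟨j, rfl⟩, (edist_mul_left S g _ _).trans_le hj⟩)
  one_smul ξ := by
    induction ξ using Quotient.inductionOn with
    | _ c => exact congrArg (Quotient.mk _) (Subtype.ext (funext fun i => one_mul (c.1 i)))
  mul_smul g h ξ := by
    induction ξ using Quotient.inductionOn with
    | _ c => exact congrArg (Quotient.mk _) (Subtype.ext (funext fun i => mul_assoc g h (c.1 i)))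

/-- The standard neighbourhood `V_n` of the endpoint of a geodesic ray `c₀` with `c₀ 0 = 1`: the
classes of the geodesic rays `c` with `c 0 = 1` and `d (c n) (c₀ n) < k`. -/
def shadow (S : Set Γ) (k : ℕ) (c₀ : GeodesicRay S) (n : ℕ) : Set (GromovBoundary S) :=
  {η | ∃ c : GeodesicRay S, c.1 0 = 1 ∧ c.endpoint = η ∧ (cayley S).edist (c.1 n) (c₀.1 n) < k}

/-- The topology of the visual boundary, in which the sets `V_n` form a neighbourhood basis.

Usually one fixes `k > 2 δ`, where `δ` is a thinness constant of the Cayley graph.  No `k` has to be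
chosen here: `shadow S k c₀ n` increases with `k`, and if `k > 2 δ`, then for every `k'` and every
`n`, the set `shadow S k' c₀ m` is contained in `shadow S k c₀ n` as soon as `m ≥ n + k' + δ`.
Hence asking for all `k` is the same as asking for one `k > 2 δ`, and asking for all large `n` is
the same as asking for some `n`. -/
instance (S : Set Γ) : TopologicalSpace (GromovBoundary S) where
  IsOpen U := ∀ c₀ : GeodesicRay S, c₀.1 0 = 1 → c₀.endpoint ∈ U →
    ∀ k : ℕ, ∀ᶠ n in atTop, shadow S k c₀ n ⊆ U
  isOpen_univ := fun _ _ _ _ => Eventually.of_forall fun _ => subset_univ _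
  isOpen_inter := fun _ _ hs ht c₀ h1 hm k => by
    filter_upwards [hs c₀ h1 hm.1 k, ht c₀ h1 hm.2 k] with n h h'
    exact subset_inter h h'
  isOpen_sUnion := fun s hs c₀ h1 ⟨t, hts, hm⟩ k => by
    filter_upwards [hs t hts c₀ h1 hm k] with n h
    exact h.trans (subset_sUnion_of_mem hts)

/-- The sequence `c` is a quasigeodesic ray whose class in the boundary is `ξ`, that is, it is at
finite Hausdorff distance from a geodesic ray with endpoint `ξ`. -/
def Represents (S : Set Γ) (c : ℕ → Γ) (ξ : GromovBoundary S) : Prop :=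
  IsQuasigeodesicRay (cayley S) c ∧
    ∃ r : GeodesicRay S, r.endpoint = ξ ∧
      ∃ N : ℕ, HausdorffClose (cayley S) N (range c) (range r.1)

end Group

/-! ### Expanding and meandering-hyperbolic actions -/

section Action

variable {Γ M ι : Type*}

/-- The objects `(I, U, s, δ, L, λ)` that make up an expansion datum.  The index sets of all data
are finite subsets of one ambient type, so that they can be compared. -/
structure Datum (Γ M ι : Type*) where
  /-- the finite index set -/
  I : Finset ι
  /-- the expanding subsets -/
  U : ι → Set M
  /-- the group elements attached to the indices -/
  s : ι → Γ
  /-- the Lebesgue number `δ` -/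
  δ : ℝ
  /-- the Lipschitz constant `L` -/
  L : ℝ
  /-- the expansion constant `λ` -/
  lam : ℝ

/-- The generating set `Σ = {s_α | α ∈ I}` of a datum. -/
def Datum.gens (D : Datum Γ M ι) : Set Γ := D.s '' (D.I : Set ι)

/-- `f` is `(λ, U; δ)`-expanding. -/
def IsExpandingOn [MetricSpace M] (f : M → M) (lam : ℝ) (U : Set M) (δ : ℝ) : Prop :=
  (∀ x ∈ U, ∀ y ∈ U, lam * dist x y ≤ dist (f x) (f y)) ∧
  ∀ (x : M) (η : ℝ), 0 < η → η ≤ δ → Metric.ball x η ⊆ U →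
    Metric.ball (f x) (lam * η) ⊆ f '' Metric.ball x η

/-- `D` is a refinement of `D₀`. -/
structure Refines (D₀ D : Datum Γ M ι) : Prop where
  I_subset : D₀.I ⊆ D.I
  U_subset : ∀ α ∈ D₀.I, D₀.U α ⊆ D.U α
  /-- the map `s` of `D` extends that of `D₀`; in particular `Σ₀ ⊆ Σ` -/
  s_eq : ∀ α ∈ D₀.I, D₀.s α = D.s α
  δ_lt : D.δ < D₀.δ
  L_le : D₀.L ≤ D.L
  lam_le : D.lam ≤ D₀.lam

/-- The ray `c_i = s_{α(0)} s_{α(1)} ⋯ s_{α(i)}` attached to a sequence `α` of indices. -/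
def Datum.ray [Group Γ] (D : Datum Γ M ι) (α : ℕ → ι) : ℕ → Γ
  | 0 => D.s (α 0)
  | i + 1 => D.ray α i * D.s (α (i + 1))

variable [Group Γ] [MetricSpace M] [MulAction Γ M]

/-- `D` is an expansion datum of the action of `Γ` on `M` at `Λ`. -/
structure IsExpansionDatum (Λ : Set M) (D : Datum Γ M ι) : Prop where
  isOpen : ∀ α ∈ D.I, IsOpen (D.U α)
  cover : Λ ⊆ ⋃ α ∈ D.I, D.U α
  one_lt_lam : 1 < D.lam
  lam_le_L : D.lam ≤ D.L
  δ_pos : 0 < D.δ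
  /-- `δ` is a Lebesgue number of the cover.  (As balls are open and `I` is finite, this is the
  same as `δ` being at most the supremum of the Lebesgue numbers.) -/
  lebesgue : ∀ x ∈ Λ, ∃ α ∈ D.I, Metric.ball x D.δ ⊆ D.U α
  lipschitz : ∀ α ∈ D.I, ∀ x ∈ Metric.thickening D.δ Λ, ∀ y ∈ Metric.thickening D.δ Λ,
    dist ((D.s α)⁻¹ • x) ((D.s α)⁻¹ • y) ≤ D.L * dist x y
  expanding : ∀ α ∈ D.I, IsExpandingOn (fun x => (D.s α)⁻¹ • x) D.lam (D.U α) D.δ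
  gens_symm : ∀ g ∈ D.gens, g⁻¹ ∈ D.gens
  gens_generate : Subgroup.closure D.gens = ⊤

/-- The points `p₀ = x`, `p_{i+1} = s_{α(i)}⁻¹ p_i` attached to a sequence `α` of indices. -/
def Datum.point (D : Datum Γ M ι) (α : ℕ → ι) (x : M) : ℕ → M
  | 0 => x
  | i + 1 => (D.s (α i))⁻¹ • D.point α x i

/-- `α` is a `(D, η)`-code for `x`; there is no condition on the expanding set of `α 0`. -/
def Datum.IsCode (D : Datum Γ M ι) (η : ℝ) (x : M) (α : ℕ → ι) : Prop :=
  (∀ i, α i ∈ D.I) ∧ ∀ i, 1 ≤ i → Metric.ball (D.point α x i) η ⊆ D.U (α i)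

/-- The set `Ray_x(D, η)`. -/
def Datum.Ray (D : Datum Γ M ι) (η : ℝ) (x : M) : Set (ℕ → Γ) :=
  {c | ∃ α, D.IsCode η x α ∧ D.ray α = c}

/-- The relation `≈` on `Ray_x(D, η)`: the two rays are within Hausdorff distance `N` along
infinite sets of times, with respect to the word metric of the generating set of `D`. -/
def Datum.Near (D : Datum Γ M ι) (η : ℝ) (N : ℕ) (x : M) (c c' : ℕ → Γ) : Prop :=
  c ∈ D.Ray η x ∧ c' ∈ D.Ray η x ∧
    ∃ P Q : Set ℕ, P.Infinite ∧ Q.Infinite ∧ HausdorffClose (cayley D.gens) N (c '' P) (c' '' Q)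

/-- `(D₀ ≺ D; N)` is a meandering hyperbolicity datum of the action: all `(D₀, δ₀)`-rays of a point
of `Λ` are equivalent under the equivalence relation on `Ray_x(D, δ)` generated by `≈`. -/
structure IsMeanderingDatum (Λ : Set M) (D₀ D : Datum Γ M ι) (N : ℕ) : Prop where
  expansion₀ : IsExpansionDatum Λ D₀
  expansion : IsExpansionDatum Λ D
  refines : Refines D₀ D
  one_le : 1 ≤ N
  equivalent : ∀ x ∈ Λ, ∀ c ∈ D₀.Ray D₀.δ x, ∀ c' ∈ D₀.Ray D₀.δ x,
    Relation.EqvGen (D.Near D.δ N x) c c'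

/-- `π` is the coding map: `π x` is the class in the Gromov boundary of every `(D₀, δ₀)`-ray
of `x`. -/
def IsCodingMap (S : Set Γ) (Λ : Set M) (D₀ : Datum Γ M ι) (π : Λ → GromovBoundary S) : Prop :=
  ∀ x : Λ, ∀ c ∈ D₀.Ray D₀.δ (x : M), Represents S c (π x)

/-- `K` is minimal among the nonempty closed `Γ`-invariant subsets of `M`. -/
def IsMinimalInvariant (Γ : Type*) {M : Type*} [Group Γ] [MetricSpace M] [MulAction Γ M]
    (K : Set M) : Prop :=
  Minimal (fun K : Set M => K.Nonempty ∧ IsClosed K ∧ ∀ g : Γ, ∀ x ∈ K, g • x ∈ K) K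

end Action

/-- The image of every set with nonempty interior has nonempty interior. -/
def IsQuasiOpen {X Y : Type*} [TopologicalSpace X] [TopologicalSpace Y] (f : X → Y) : Prop :=
  ∀ A : Set X, (interior A).Nonempty → (interior (f '' A)).Nonempty

end MeanderingHyperbolic

open MeanderingHyperbolic

/-! Each letter of a code expands distances near the current point of `Λ` by at least `λ`, while a
word of length `ℓ` is Lipschitz with constant `L ^ ℓ` near any point of `Λ`. Comparing both at a
point of `Λ`, which is not isolated, gives `λ ^ m ≤ L ^ ℓ` with `ℓ` the word distance of `c i` and
`c (i + m)`. So all rays are uniformly bi-Lipschitz (`IsExpansionDatum.exists_biLip`). By the Morse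
lemma each has an endpoint in the boundary, and rays that are close along infinite sets of times
have the same endpoint. Hence `≈` preserves endpoints and `π` is well defined.

Equivariance comes from prepending a letter to a code. For continuity, the slack `δ < δ₀` lets a
point `y` near `x` use the code of `x` for a long time before switching to a code of the point
reached; the spliced code is a `D`-code of `y`, and its ray agrees with one of `x` up to that time
(`exists_forall_eventually_dist_le`).

On an invariant set `K`, `π` is not constant: its only value would be fixed by `Γ`, but a
non-elementary hyperbolic group has no boundary point with stabilizer of finite index
(`isElementary_of_finiteIndex_stabilizer`). Given values `a ≠ b` of `π` on `K` and a ray `r` from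
`1` to `ξ`, for every `n` one of `r n • a`, `r n • b` lies in a shadow of `r` at time `n`
(`exists_smul_mem_shadow`); compactness of `K` then yields a preimage of `ξ`.

If `K` is minimal, finitely many translates of a set with interior cover `K`, so finitely many
translates of its image cover the boundary, and one closed piece has interior. An isolated point of
`K` would make `K`, hence the boundary, finite, and stabilizers would again have finite index. -/

namespace MeanderingHyperbolic

/-! ### Integer-valued geodesic metrics -/

section IntMetric

variable {V : Type*}

/-- An integer-valued metric in which any two points are joined by a discrete geodesic. -/
structure IsGeodesicMetric (d : V → V → ℕ) : Prop where
  self : ∀ x, d x x = 0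
  eq_of_eq_zero : ∀ {x y}, d x y = 0 → x = y
  comm : ∀ x y, d x y = d y x
  triangle : ∀ x y z, d x z ≤ d x y + d y z
  exists_geodesic : ∀ x y, ∃ c : ℕ → V, c 0 = x ∧ c (d x y) = y ∧
    ∀ i m, i + m ≤ d x y → d (c i) (c (i + m)) = m

/-- The point `p` lies on a geodesic from `x` to `y`. -/
def Between (d : V → V → ℕ) (x p y : V) : Prop := d x p + d p y = d x y

/-- Thin triangles, phrased in terms of metric intervals. -/
def ThinIntervals (d : V → V → ℕ) (δ : ℕ) : Prop :=
  ∀ x y z p, Between d x p y → ∃ q, d p q ≤ δ ∧ (Between d x q z ∨ Between d y q z)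

/-- `q` is bi-Lipschitz with constant `A` on the integer interval `[a, b]`. -/
def BiLipOn (d : V → V → ℕ) (A : ℕ) (q : ℕ → V) (a b : ℕ) : Prop :=
  ∀ i m, a ≤ i → i + m ≤ b → d (q i) (q (i + m)) ≤ A * m ∧ m ≤ A * d (q i) (q (i + m))

variable {d : V → V → ℕ} (hd : IsGeodesicMetric d) {δ A : ℕ}

include hd in
theorem Between.symm {x p y : V} (h : Between d x p y) : Between d y p x := by
  unfold Between at *
  rw [hd.comm y p, hd.comm p x, hd.comm y x]; omega

include hd in
theorem exists_between (x y : V) (n : ℕ) (hn : n ≤ d x y) :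
    ∃ p, Between d x p y ∧ d x p = n := by
  obtain ⟨c, h0, h1, h⟩ := hd.exists_geodesic x y
  have e1 := h 0 n (by omega)
  have e2 := h n (d x y - n) (by omega)
  rw [Nat.add_sub_cancel' hn, h1] at e2
  rw [Nat.zero_add, h0] at e1
  exact ⟨c n, by unfold Between; omega, e1⟩

include hd in
theorem between_of_between_of_between {x y p u v : V} (hp : Between d x p y)
    (hu : Between d x u p) (hv : Between d p v y) :
    Between d x u y ∧ Between d x v y ∧ Between d u p v := by
  unfold Between at *
  have := hd.triangle x u y
  have := hd.triangle u p y
  have := hd.triangle x v y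
  have := hd.triangle x p v
  have := hd.triangle u p v
  have := hd.triangle x u v
  have := hd.triangle u v y
  refine ⟨?_, ?_, ?_⟩ <;> omega

include hd in
theorem ThinIntervals.bigon (hT : ThinIntervals d δ) {x y p q : V} (hp : Between d x p y)
    (hq : Between d x q y) (h : d x p = d x q) : d p q ≤ 2 * δ := by
  -- The third vertex is `q` itself. As `p` and `q` are at equal distance from each of `x` and `y`,
  -- the point `s` is within `δ` of `q` too.
  obtain ⟨s, hs, hs'⟩ := hT x y q p hp
  unfold Between at *
  have := hd.triangle p s q
  rcases hs' with hs' | hs'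
  · have := hd.triangle x s p
    have := hd.comm s p
    omega
  · have := hd.triangle y s p
    have := hd.comm s p
    have := hd.comm y p
    have := hd.comm y q
    omega

/-- The diagonal from `x` to `z` cuts the quadrilateral into two thin triangles. -/
theorem ThinIntervals.quadrilateral (hd : IsGeodesicMetric d) (hT : ThinIntervals d δ)
    {x y : V} (z w : V) {p : V} (hp : Between d x p y) :
    ∃ q, d p q ≤ 2 * δ ∧ (Between d y q z ∨ Between d z q w ∨ Between d x q w) := by
  obtain ⟨q, hq, hq'⟩ := hT x y z p hp
  rcases hq' with hq' | hq'
  · obtain ⟨s, hs, hs'⟩ := hT x z w q hq'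
    have := hd.triangle p q s
    exact ⟨s, by omega, by tauto⟩
  · exact ⟨q, by omega, Or.inl hq'⟩

/-- A point on a geodesic is logarithmically close to any path with the same endpoints. -/
theorem ThinIntervals.exists_near_path (hd : IsGeodesicMetric d) (hT : ThinIntervals d δ)
    (q : ℕ → V) (n : ℕ) : ∀ a b p, a ≤ b → b ≤ a + 2 ^ n →
      (∀ i, a ≤ i → i < b → d (q i) (q (i + 1)) ≤ A) → Between d (q a) p (q b) →
      ∃ j, a ≤ j ∧ j ≤ b ∧ d p (q j) ≤ n * δ + A := by
  induction n with
  | zero =>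
    intro a b p hab hb hq hp
    refine ⟨a, le_rfl, hab, ?_⟩
    unfold Between at hp
    have := hd.comm p (q a)
    rcases (by omega : b = a ∨ b = a + 1) with rfl | rfl
    · have := hd.self (q b)
      omega
    · have := hq a le_rfl (by omega)
      omega
  | succ n ih =>
    intro a b p hab hb hq hp
    rw [pow_succ] at hb
    -- Bisection of the path: the triangle with apex `q m` moves `p` by at most `δ` onto a geodesic
    -- that spans one half.
    obtain ⟨m, hm⟩ : ∃ m, m = min (a + 2 ^ n) b := ⟨_, rfl⟩
    obtain ⟨s, hs, hs'⟩ := hT _ _ (q m) p hp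
    rcases hs' with hs' | hs'
    · obtain ⟨j, h1, h2, h3⟩ := ih a m s (by omega) (by omega)
        (fun i hi hi' => hq i hi (by omega)) hs'
      have := hd.triangle p s (q j)
      exact ⟨j, h1, by omega, by rw [add_mul]; omega⟩
    · obtain ⟨j, h1, h2, h3⟩ := ih m b s (by omega) (by omega)
        (fun i hi hi' => hq i (by omega) hi') (hs'.symm hd)
      have := hd.triangle p s (q j)
      exact ⟨j, by omega, h2, by rw [add_mul]; omega⟩

theorem exists_forall_linear_le_two_pow (a b : ℕ) : ∃ n₀, ∀ n, n₀ ≤ n → a + b * n < 2 ^ n := by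
  refine ⟨2 * (a + 3 * b + 1), fun n hn => ?_⟩
  obtain ⟨m, hm⟩ : ∃ m, m = n / 2 := ⟨_, rfl⟩
  have h1 : 2 ^ m * 2 ^ m ≤ 2 ^ n := by
    rw [← pow_add]; exact Nat.pow_le_pow_right (by norm_num) (by omega)
  have h2 : m + 1 ≤ 2 ^ m := Nat.lt_two_pow_self
  have h3 : (m + 1) * (m + 1) ≤ 2 ^ m * 2 ^ m := Nat.mul_le_mul h2 h2
  have h4 : n ≤ 2 * m + 1 := by omega
  have h5 : b * n ≤ b * (2 * m + 1) := Nat.mul_le_mul_left _ h4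
  have h6 : (a + 3 * b + 1) * (m + 1) ≤ (m + 1) * (m + 1) := Nat.mul_le_mul_right _ (by omega)
  nlinarith [Nat.zero_le (a * m), Nat.zero_le (b * m)]

/-- One half of the Morse lemma: geodesics stay close to quasigeodesics. -/
theorem ThinIntervals.exists_geodesic_near_biLip (hd : IsGeodesicMetric d)
    (hT : ThinIntervals d δ) (A : ℕ) : ∃ D, ∀ q a b, a ≤ b → BiLipOn d A q a b →
      ∀ p, Between d (q a) p (q b) → ∃ j, a ≤ j ∧ j ≤ b ∧ d p (q j) ≤ D := by
  classical
  obtain ⟨n₀, hn₀⟩ :=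
    exists_forall_linear_le_two_pow (6 * A * (3 * δ + A)) (6 * A * δ)
  refine ⟨3 * δ + A + n₀ * δ, fun q a b hab hq p hp => ?_⟩
  by_contra! hcon
  -- Take the geodesic point `p` farthest from the path, at distance `D`. Points `u`, `v` at
  -- distance at most `2 D` on both sides of `p` are `D`-close to path points `q i`, `q j`. The
  -- piece of path between these has length linear in `D` but stays `D` away from `p`, whereas a
  -- path must come logarithmically close to a geodesic; so `D` is bounded.
  let Far : ℕ → Prop := fun D => ∃ p, Between d (q a) p (q b) ∧
    ∀ j, a ≤ j → j ≤ b → D ≤ d p (q j)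
  have hbound : ∀ D, Far D → D ≤ d (q a) (q b) := by
    rintro D ⟨p, hp, h⟩
    have := h a le_rfl hab
    have := hd.comm p (q a)
    unfold Between at hp
    omega
  have hfar : Far (3 * δ + A + n₀ * δ + 1) := ⟨p, hp, fun j h1 h2 => hcon j h1 h2⟩
  obtain ⟨D, hD⟩ : ∃ D, D = Nat.findGreatest Far (d (q a) (q b)) := ⟨_, rfl⟩
  have hDfar : Far D := by
    rw [hD]; exact Nat.findGreatest_spec (hbound _ hfar) hfar
  have hDge : 3 * δ + A + n₀ * δ + 1 ≤ D := by
    rw [hD]; exact Nat.le_findGreatest (hbound _ hfar) hfar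
  have hDmax : ∀ p, Between d (q a) p (q b) → ∃ j, a ≤ j ∧ j ≤ b ∧ d p (q j) ≤ D := by
    intro p hp
    by_contra! h
    have hF : Far (D + 1) := ⟨p, hp, fun j h1 h2 => h j h1 h2⟩
    have := Nat.le_findGreatest (hbound _ hF) hF
    omega
  clear hp hcon p
  obtain ⟨p, hp, hpfar⟩ := hDfar
  -- `u` and `v` are at distance `2 D` from `p`, unless they are endpoints
  have key : ∀ x e, x = q e → a ≤ e → e ≤ b → (∀ u, Between d x u p → Between d (q a) u (q b)) →
      ∃ u j, Between d x u p ∧ a ≤ j ∧ j ≤ b ∧ d u p ≤ 2 * D ∧ d u (q j) ≤ D ∧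
        ∀ s, Between d u s (q j) → D ≤ d p s := by
    intro x e hxe he1 he2 hx
    rcases le_total (d x p) (2 * D) with h | h
    · refine ⟨x, e, by simp [Between, hd.self], he1, he2, h, by simp [hxe, hd.self], ?_⟩
      intro s hs
      have h1 := hpfar e he1 he2
      rw [hxe, Between, hd.self] at hs
      have : q e = s := hd.eq_of_eq_zero (by omega)
      rwa [← this]
    · obtain ⟨u, hu, hu'⟩ := exists_between hd x p (d x p - 2 * D) (by omega)
      obtain ⟨j, h1, h2, h3⟩ := hDmax u (hx u hu)
      refine ⟨u, j, hu, h1, h2, by unfold Between at hu; omega, h3, fun s hs => ?_⟩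
      unfold Between at hu hs
      have := hd.triangle u s p
      have := hd.comm p s
      omega
  obtain ⟨u, i, hu, hi1, hi2, hup, hui, hus⟩ := key (q a) a rfl le_rfl hab
    (fun u hu => (between_of_between_of_between hd hp hu (v := p)
      (by simp [Between, hd.self])).1)
  obtain ⟨v, j, hv, hj1, hj2, hvp, hvj, hvs⟩ := key (q b) b rfl hab le_rfl
    (fun v hv => (between_of_between_of_between hd hp (u := p)
      (by simp [Between, hd.self]) (hv.symm hd)).2.1)
  obtain ⟨-, -, huv⟩ := between_of_between_of_between hd hp hu (hv.symm hd)
  obtain ⟨s, hs, hs'⟩ := hT.quadrilateral hd (q j) (q i) huv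
  have hsD : 2 * δ < D := by omega
  rcases hs' with hs' | hs' | hs'
  · have := hvs s hs'; omega
  swap
  · have := hus s hs'; omega
  -- the middle side
  have hij : d (q i) (q j) ≤ 6 * D := by
    have := hd.triangle (q i) u (q j)
    have := hd.triangle u p (q j)
    have := hd.triangle p v (q j)
    have := hd.comm (q i) u
    have := hd.comm v p
    omega
  have main : ∀ i j, a ≤ i → i ≤ j → j ≤ b → d (q i) (q j) ≤ 6 * D → Between d (q i) s (q j) →
      False := by
    intro i j hi hij hj hdij hs'
    obtain ⟨m, rfl⟩ := Nat.exists_eq_add_of_le hij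
    have hm : m ≤ 6 * A * D := ((hq i m hi hj).2.trans (Nat.mul_le_mul_left A hdij)).trans
      (by apply le_of_eq; ring)
    obtain ⟨n, hn⟩ : ∃ n, n = Nat.clog 2 (6 * A * D) := ⟨_, rfl⟩
    have hle : 6 * A * D ≤ 2 ^ n := hn ▸ Nat.le_pow_clog (by norm_num) _
    obtain ⟨t, ht1, ht2, ht3⟩ := hT.exists_near_path hd (A := A) q n i (i + m) s (by omega)
      (by omega) (fun k hk hk' => by simpa using (hq k 1 (by omega) (by omega)).1) hs'
    have h1 := hpfar t (by omega) (by omega)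
    have h2 := hd.triangle p s (q t)
    have hDn : D ≤ 2 * δ + n * δ + A := by omega
    have hnn : n₀ + 1 ≤ n := by
      by_contra! h
      have : n * δ ≤ n₀ * δ := Nat.mul_le_mul_right _ (by omega)
      omega
    -- The exponent `n` is the logarithm of the path length, so `2 ^ (n - 1) < 6 A D`, while `D ≤ 2
    -- δ + n δ + A`; `n₀` was chosen to make these incompatible.
    have h3 := hn₀ (n - 1) (by omega)
    have h4 : 2 ^ (n - 1) < 6 * A * D := by
      rw [hn]
      refine Nat.pow_pred_clog_lt_self (by norm_num) ?_
      by_contra! h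
      have := Nat.clog_mono_right 2 h
      simp at this
      omega
    obtain ⟨k, rfl⟩ : ∃ k, n = k + 1 := ⟨n - 1, by omega⟩
    rw [Nat.add_sub_cancel] at h3 h4
    have h5 : 6 * A * D ≤ 6 * A * (2 * δ + (k + 1) * δ + A) := Nat.mul_le_mul_left _ hDn
    have h6 : 6 * A * (2 * δ + (k + 1) * δ + A) = 6 * A * (3 * δ + A) + 6 * A * δ * k := by ring
    omega
  rcases le_total i j with h | h
  · exact main i j hi1 h hj2 hij (hs'.symm hd)
  · exact main j i hj1 h hi2 (by rw [hd.comm]; exact hij) hs'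

/-- The other half of the Morse lemma: quasigeodesics stay close to geodesics. -/
theorem ThinIntervals.exists_biLip_near_geodesic (hd : IsGeodesicMetric d)
    (hT : ThinIntervals d δ) (A : ℕ) : ∃ R, ∀ q a b, BiLipOn d A q a b →
      ∀ c : ℕ → V, c 0 = q a → c (d (q a) (q b)) = q b →
        (∀ i m, i + m ≤ d (q a) (q b) → d (c i) (c (i + m)) = m) →
      ∀ j, a ≤ j → j ≤ b → ∃ i ≤ d (q a) (q b), d (c i) (q j) ≤ R := by
  classical
  obtain ⟨D, hD⟩ := hT.exists_geodesic_near_biLip hd A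
  refine ⟨D + A * (A * (2 * D + 1)), fun q a b hq c hc0 hc1 hc j ha hb => ?_⟩
  have hab : a ≤ b := ha.trans hb
  -- Let `i` be the last time at which the geodesic is near the part of `q` before `j`. One step
  -- later it is near the part after `j`. Thus `q` visits nearby points at times `t ≤ j ≤ t'`, and
  -- the lower bi-Lipschitz bound keeps `t' - t` bounded.
  let P : ℕ → Prop := fun i => ∃ t, a ≤ t ∧ t ≤ j ∧ d (c i) (q t) ≤ D
  have hP0 : P 0 := ⟨a, le_rfl, ha, by simp [hc0, hd.self]⟩
  obtain ⟨i, hi⟩ : ∃ i, i = Nat.findGreatest P (d (q a) (q b)) := ⟨_, rfl⟩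
  have hiP : P i := by rw [hi]; exact Nat.findGreatest_spec (Nat.zero_le _) hP0
  have hile : i ≤ d (q a) (q b) := by rw [hi]; exact Nat.findGreatest_le _
  obtain ⟨t, hat, htj, ht⟩ := hiP
  -- a later time `t'` with `q t'` near `c i`
  obtain ⟨t', hjt', ht'b, ht'⟩ : ∃ t', j ≤ t' ∧ t' ≤ b ∧ d (c i) (q t') ≤ D + 1 := by
    rcases hile.eq_or_lt with h | h
    · exact ⟨b, hb, le_rfl, by rw [h, hc1, hd.self]; omega⟩
    · have hbet : Between d (q a) (c (i + 1)) (q b) := by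
        have e1 := hc 0 (i + 1) (by omega)
        have e2 := hc (i + 1) (d (q a) (q b) - (i + 1)) (by omega)
        rw [show i + 1 + (d (q a) (q b) - (i + 1)) = d (q a) (q b) by omega, hc1] at e2
        rw [Nat.zero_add, hc0] at e1
        unfold Between; omega
      obtain ⟨t', h1, h2, h3⟩ := hD q a b hab hq _ hbet
      refine ⟨t', ?_, h2, ?_⟩
      · by_contra! hlt
        have : P (i + 1) := ⟨t', h1, hlt.le, h3⟩
        have := Nat.le_findGreatest (n := d (q a) (q b)) (by omega) this
        omega
      · have := hd.triangle (c i) (c (i + 1)) (q t')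
        have := hc i 1 (by omega)
        omega
  refine ⟨i, hile, ?_⟩
  obtain ⟨m, rfl⟩ := Nat.exists_eq_add_of_le htj
  obtain ⟨k, rfl⟩ := Nat.exists_eq_add_of_le hjt'
  have h1 : d (q t) (q (t + (m + k))) ≤ 2 * D + 1 := by
    rw [← add_assoc]
    have := hd.triangle (q t) (c i) (q (t + m + k))
    have := hd.comm (c i) (q t)
    omega
  have h2 := (hq t (m + k) hat (by omega)).2
  have h3 := (hq t m hat (by omega)).1
  have h4 : m ≤ A * (2 * D + 1) :=
    (by omega : m ≤ m + k).trans (h2.trans (Nat.mul_le_mul_left _ h1))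
  have h5 := h3.trans (Nat.mul_le_mul_left A h4)
  have := hd.triangle (c i) (q t) (q (t + m))
  omega

theorem between_of_geodesic {x y : V} {c : ℕ → V} (h0 : c 0 = x) (h1 : c (d x y) = y)
    (h : ∀ i m, i + m ≤ d x y → d (c i) (c (i + m)) = m) {i : ℕ} (hi : i ≤ d x y) :
    Between d x (c i) y := by
  have e1 := h 0 i (by omega)
  have e2 := h i (d x y - i) (by omega)
  rw [Nat.add_sub_cancel' hi, h1] at e2
  rw [Nat.zero_add, h0] at e1
  unfold Between; omega

include hd in
theorem Between.exists_geodesic {x p y : V} (hp : Between d x p y) :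
    ∃ c : ℕ → V, c 0 = x ∧ c (d x y) = y ∧ c (d x p) = p ∧
      ∀ i m, i + m ≤ d x y → d (c i) (c (i + m)) = m := by
  obtain ⟨c₁, h0, h1, h⟩ := hd.exists_geodesic x p
  obtain ⟨c₂, k0, k1, k⟩ := hd.exists_geodesic p y
  have hxy : d x y = d x p + d p y := Eq.symm hp
  refine ⟨fun i => if i ≤ d x p then c₁ i else c₂ (i - d x p), by simp [h0], ?_, by simp [h1], ?_⟩
  · dsimp only
    split_ifs with hle
    · have h' : d p y = 0 := by omega
      have : p = y := hd.eq_of_eq_zero h'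
      rw [hxy, h', add_zero, h1, this]
    · rw [hxy, Nat.add_sub_cancel_left, k1]
  intro i m him
  by_cases hi : i + m ≤ d x p
  · simp only [if_pos hi, if_pos (show i ≤ d x p by omega)]
    exact h i m hi
  by_cases hi' : i ≤ d x p
  · simp only [if_neg hi, if_pos hi']
    have e1 := h 0 i (by omega)
    have e2 := h i (d x p - i) (by omega)
    have e3 := k 0 (i + m - d x p) (by omega)
    have e4 := k (i + m - d x p) (d x y - (i + m)) (by omega)
    rw [show i + m - d x p + (d x y - (i + m)) = d p y by omega, k1] at e4
    rw [Nat.add_sub_cancel' hi', h1] at e2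
    rw [Nat.zero_add, h0] at e1
    rw [Nat.zero_add, k0] at e3
    have := hd.triangle x (c₁ i) y
    have := hd.triangle (c₁ i) (c₂ (i + m - d x p)) y
    have := hd.triangle (c₁ i) p (c₂ (i + m - d x p))
    omega
  · simp only [if_neg hi, if_neg hi']
    have := k (i - d x p) m (by omega)
    rwa [show i - d x p + m = i + m - d x p by omega] at this

/-- Hyperbolicity is invariant under bi-Lipschitz changes of the metric. -/
theorem ThinIntervals.of_biLip {d' : V → V → ℕ} (hd : IsGeodesicMetric d)
    (hd' : IsGeodesicMetric d') (hT : ThinIntervals d δ) (B : ℕ)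
    (h₁ : ∀ x y, d' x y ≤ B * d x y) (h₂ : ∀ x y, d x y ≤ B * d' x y) :
    ∃ δ', ThinIntervals d' δ' := by
  obtain ⟨D, hD⟩ := hT.exists_geodesic_near_biLip hd B
  obtain ⟨R, hR⟩ := hT.exists_biLip_near_geodesic hd B
  have biLip : ∀ {x y} {c : ℕ → V}, (∀ i m, i + m ≤ d' x y → d' (c i) (c (i + m)) = m) →
      BiLipOn d B c 0 (d' x y) := by
    intro x y c h i m _ hm
    have := h i m hm
    have e1 := h₁ (c i) (c (i + m))
    have e2 := h₂ (c i) (c (i + m))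
    rw [this] at e1 e2
    exact ⟨e2, e1⟩
  -- a `d`-interval is near the `d'`-interval
  have near : ∀ x y p, Between d x p y → ∃ q, Between d' x q y ∧ d p q ≤ D := by
    intro x y p hp
    obtain ⟨c, h0, h1, h⟩ := hd'.exists_geodesic x y
    obtain ⟨j, -, hj, hpj⟩ := hD c 0 _ (Nat.zero_le _) (biLip h) p (by rw [h0, h1]; exact hp)
    exact ⟨c j, between_of_geodesic h0 h1 h hj, hpj⟩
  refine ⟨B * (R + δ + D), fun x y z p hp => ?_⟩
  -- Geodesics of `d'` are quasigeodesics of `d`: move `p` to a `d`-geodesic, use thinness there,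
  -- and return to a `d'`-geodesic.
  obtain ⟨p', hp', hpp'⟩ : ∃ p', Between d x p' y ∧ d p p' ≤ R := by
    obtain ⟨c, c0, c1, cp, hc⟩ := hp.exists_geodesic hd'
    have hpxy : d' x p ≤ d' x y := by unfold Between at hp; omega
    obtain ⟨g, g0, g1, hg⟩ := hd.exists_geodesic (c 0) (c (d' x y))
    obtain ⟨i, hi, hi'⟩ := hR c 0 _ (biLip hc) g g0 g1 hg (d' x p) (Nat.zero_le _) hpxy
    refine ⟨g i, ?_, ?_⟩
    · have := between_of_geodesic g0 g1 hg hi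
      rwa [c0, c1] at this
    · rw [cp, hd.comm] at hi'; omega
  obtain ⟨q, hq, hq'⟩ := hT x y z p' hp'
  obtain ⟨s, hs, hs'⟩ : ∃ s, (Between d' x s z ∨ Between d' y s z) ∧ d q s ≤ D := by
    rcases hq' with hq' | hq'
    · obtain ⟨s, hs⟩ := near _ _ _ hq'
      exact ⟨s, Or.inl hs.1, hs.2⟩
    · obtain ⟨s, hs⟩ := near _ _ _ hq'
      exact ⟨s, Or.inr hs.1, hs.2⟩
  refine ⟨s, (h₁ p s).trans (Nat.mul_le_mul_left _ ?_), hs⟩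
  have := hd.triangle p p' s
  have := hd.triangle p' q s
  omega

end IntMetric

/-! ### The path metric of a connected graph -/

section GraphMetric

variable {V : Type*} {G : SimpleGraph V}

theorem exists_geodesicSegment (hG : G.Connected) (x y : V) :
    ∃ c : ℕ → V, c 0 = x ∧ c (G.dist x y) = y ∧
      ∀ i m, i + m ≤ G.dist x y → G.dist (c i) (c (i + m)) = m := by
  obtain ⟨p, hp⟩ := hG.exists_walk_length_eq_dist x y
  have hstep : ∀ i m, G.dist (p.getVert i) (p.getVert (i + m)) ≤ m := by
    intro i m
    induction m with
    | zero => simp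
    | succ m ih =>
      have h1 := hG.dist_triangle (u := p.getVert i) (v := p.getVert (i + m))
        (w := p.getVert (i + (m + 1)))
      have h2 : G.dist (p.getVert (i + m)) (p.getVert (i + m + 1)) ≤ 1 := by
        rcases lt_or_ge (i + m) p.length with h | h
        · exact (SimpleGraph.dist_eq_one_iff_adj.2 (p.adj_getVert_succ h)).le
        · rw [p.getVert_of_length_le h, p.getVert_of_length_le (by omega)]; simp
      rw [← add_assoc] at h1 ⊢
      omega
  refine ⟨p.getVert, p.getVert_zero, by rw [← hp, p.getVert_length], fun i m him => ?_⟩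
  -- The three upper bounds add up to the distance of the endpoints, so each is an equality.
  have e1 := hstep 0 i
  have e2 := hstep (i + m) (G.dist x y - (i + m))
  rw [show i + m + (G.dist x y - (i + m)) = G.dist x y by omega, ← hp, p.getVert_length, hp] at e2
  rw [Nat.zero_add, p.getVert_zero] at e1
  have := hstep i m
  have := hG.dist_triangle (u := x) (v := p.getVert i) (w := y)
  have := hG.dist_triangle (u := p.getVert i) (v := p.getVert (i + m)) (w := y)
  omega

theorem isGeodesicMetric_dist (hG : G.Connected) : IsGeodesicMetric G.dist where
  self _ := SimpleGraph.dist_self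
  eq_of_eq_zero h := hG.dist_eq_zero_iff.1 h
  comm _ _ := SimpleGraph.dist_comm
  triangle _ _ _ := hG.dist_triangle
  exists_geodesic := exists_geodesicSegment hG

theorem edist_le_coe_iff (hG : G.Connected) {x y : V} {n : ℕ} :
    G.edist x y ≤ n ↔ G.dist x y ≤ n := by
  rw [← (hG.preconnected x y).coe_dist_eq_edist, Nat.cast_le]

theorem edist_lt_coe_iff (hG : G.Connected) {x y : V} {n : ℕ} :
    G.edist x y < n ↔ G.dist x y < n := by
  rw [← (hG.preconnected x y).coe_dist_eq_edist, Nat.cast_lt]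

theorem edist_eq_coe_iff (hG : G.Connected) {x y : V} {n : ℕ} :
    G.edist x y = n ↔ G.dist x y = n := by
  rw [← (hG.preconnected x y).coe_dist_eq_edist, Nat.cast_inj]

theorem HasThinTriangles.thinIntervals (hG : G.Connected) {δ : ℕ} (h : HasThinTriangles G δ) :
    ThinIntervals G.dist δ := by
  intro x y z p hp
  have hd := isGeodesicMetric_dist hG
  obtain ⟨c, c0, c1, cp, hc⟩ := hp.exists_geodesic hd
  obtain ⟨b, b0, b1, hb⟩ := exists_geodesicSegment hG y z
  obtain ⟨e, e0, e1, he⟩ := exists_geodesicSegment hG z x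
  have seg : ∀ {u v : V} {f : ℕ → V}, (∀ i m, i + m ≤ G.dist u v → G.dist (f i) (f (i + m)) = m) →
      IsGeodesicSegment G (G.dist u v) f :=
    fun hf i m him => (edist_eq_coe_iff hG).2 (hf i m him)
  rcases h _ _ _ c b e (seg hc) (seg hb) (seg he) (by rw [c1, b0]) (by rw [b1, e0])
    (by rw [e1, c0]) (G.dist x p) (by unfold Between at hp; omega) with ⟨j, hj, hj'⟩ | ⟨j, hj, hj'⟩
  · rw [edist_le_coe_iff hG, cp] at hj'
    exact ⟨_, hj', Or.inr (between_of_geodesic b0 b1 hb hj)⟩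
  · rw [edist_le_coe_iff hG, cp] at hj'
    exact ⟨_, hj', Or.inl ((between_of_geodesic e0 e1 he hj).symm hd)⟩

end GraphMetric

/-! ### Rays in hyperbolic spaces -/

section Rays

variable {V : Type*} {d : V → V → ℕ} {δ A : ℕ}

/-- Discrete geodesic rays of an integer-valued metric. -/
def IsRay (d : V → V → ℕ) (c : ℕ → V) : Prop :=
  ∀ i m, d (c i) (c (i + m)) = m

/-- Bi-Lipschitz rays. -/
def BiLip (d : V → V → ℕ) (A : ℕ) (q : ℕ → V) : Prop :=
  ∀ i m, d (q i) (q (i + m)) ≤ A * m ∧ m ≤ A * d (q i) (q (i + m))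

theorem BiLip.biLipOn {q : ℕ → V} (h : BiLip d A q) (a b : ℕ) : BiLipOn d A q a b :=
  fun i m _ _ => h i m

theorem IsRay.between {c : ℕ → V} (hc : IsRay d c) {i n : ℕ} (h : i ≤ n) :
    Between d (c 0) (c i) (c n) := by
  have e1 := hc 0 i
  have e2 := hc i (n - i)
  have e3 := hc 0 n
  rw [Nat.add_sub_cancel' h] at e2
  rw [Nat.zero_add] at e1 e3
  unfold Between; omega

theorem IsRay.dist_zero {c : ℕ → V} (hc : IsRay d c) (i : ℕ) : d (c 0) (c i) = i := by
  simpa using hc 0 i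

/-- Times are distances from the starting points, so `i` and `j` differ by at most `d (c i) (c' j) +
d (c 0) (c' 0)`. -/
theorem IsRay.dist_comp_le (hd : IsGeodesicMetric d) {c c' : ℕ → V} (hc : IsRay d c)
    (hc' : IsRay d c') {i j : ℕ} :
    d (c i) (c' i) ≤ 2 * d (c i) (c' j) + d (c 0) (c' 0) := by
  have h1 := hc.dist_zero i
  have h2 := hc'.dist_zero j
  have := hd.triangle (c 0) (c' 0) (c' j)
  have := hd.triangle (c' 0) (c 0) (c i)
  have := hd.triangle (c 0) (c' j) (c i)
  have := hd.triangle (c' 0) (c i) (c' j)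
  have := hd.comm (c 0) (c' 0)
  have := hd.comm (c i) (c' j)
  rcases le_total i j with h | h
  · have h3 := hc' i (j - i)
    rw [Nat.add_sub_cancel' h] at h3
    have := hd.triangle (c i) (c' j) (c' i)
    have := hd.comm (c' i) (c' j)
    omega
  · have h3 := hc' j (i - j)
    rw [Nat.add_sub_cancel' h] at h3
    have := hd.triangle (c i) (c' j) (c' i)
    omega

theorem ThinIntervals.exists_near_ray_of_between (hd : IsGeodesicMetric d)
    (hT : ThinIntervals d δ) {c : ℕ → V} (hc : IsRay d c) {q : V} {n : ℕ}
    (hq : Between d (c 0) q (c n)) : d q (c (d (c 0) q)) ≤ 2 * δ := by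
  refine hT.bigon hd hq (hc.between ?_) (hc.dist_zero _).symm
  have := hc.dist_zero n
  unfold Between at hq; omega

/-- In the quadrilateral with vertices `c 0`, `c a`, `c' b`, `c' 0`, the bounds on `i` put `c i` too
far from the two short sides, so it is close to the side along `c'`. -/
theorem ThinIntervals.exists_near_ray (hd : IsGeodesicMetric d) (hT : ThinIntervals d δ)
    {c c' : ℕ → V} (hc : IsRay d c) (hc' : IsRay d c') {i a b H : ℕ} (hab : d (c a) (c' b) ≤ H)
    (hi : 2 * δ + d (c 0) (c' 0) < i) (hia : i + 2 * δ + H < a) :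
    ∃ j, d (c i) (c' j) ≤ 4 * δ := by
  obtain ⟨q, hq, hq'⟩ := hT.quadrilateral hd (c' b) (c' 0) (hc.between (by omega : i ≤ a))
  rcases hq' with hq' | hq' | hq'
  · have := hd.triangle (c i) q (c a)
    have := hd.comm q (c a)
    have h := hc i (a - i)
    rw [Nat.add_sub_cancel' (by omega)] at h
    unfold Between at hq'
    omega
  · have := hT.exists_near_ray_of_between hd hc' (hq'.symm hd)
    have := hd.triangle (c i) q (c' (d (c' 0) q))
    exact ⟨d (c' 0) q, by omega⟩
  · have := hd.triangle (c 0) q (c i)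
    have := hd.comm q (c i)
    have := hc.dist_zero i
    unfold Between at hq'
    omega

/-- Asymptotic rays are uniformly close from a certain time on. -/
theorem ThinIntervals.eventually_near_ray (hd : IsGeodesicMetric d) (hT : ThinIntervals d δ)
    {c c' : ℕ → V} (hc : IsRay d c) (hc' : IsRay d c') {H : ℕ}
    (h : ∃ᶠ i in atTop, ∃ j, d (c i) (c' j) ≤ H) {i : ℕ} (hi : 2 * δ + d (c 0) (c' 0) < i) :
    ∃ j, d (c i) (c' j) ≤ 4 * δ := by
  obtain ⟨a, ha, b, hab⟩ := (frequently_atTop.1 h) (i + 2 * δ + H + 1)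
  exact hT.exists_near_ray hd hc hc' hab hi (by omega)

/-- Asymptotic rays stay close to each other at equal times. -/
theorem ThinIntervals.dist_ray_le (hd : IsGeodesicMetric d) (hT : ThinIntervals d δ)
    {c c' : ℕ → V} (hc : IsRay d c) (hc' : IsRay d c') {H : ℕ}
    (h : ∃ᶠ i in atTop, ∃ j, d (c i) (c' j) ≤ H) (i : ℕ) :
    d (c i) (c' i) ≤ 8 * δ + 3 * d (c 0) (c' 0) := by
  rcases le_or_gt i (2 * δ + d (c 0) (c' 0)) with hi | hi
  · have := hc.dist_zero i
    have := hc'.dist_zero i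
    have := hd.triangle (c i) (c 0) (c' i)
    have := hd.triangle (c 0) (c' 0) (c' i)
    have := hd.comm (c i) (c 0)
    omega
  · obtain ⟨j, hj⟩ := hT.eventually_near_ray hd hc hc' h hi
    have := hc.dist_comp_le hd hc' (i := i) (j := j)
    omega

/-- Two rays from the same point that are close at one time are close at all earlier times. -/
theorem ThinIntervals.dist_ray_le_of_dist_le (hd : IsGeodesicMetric d) (hT : ThinIntervals d δ)
    {c c' : ℕ → V} (hc : IsRay d c) (hc' : IsRay d c') (h0 : c 0 = c' 0) {n k : ℕ}
    (h : d (c n) (c' n) ≤ k) {i : ℕ} (hi : i ≤ n) : d (c i) (c' i) ≤ 8 * δ + 3 * k := by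
  have hself := hd.self (c' 0)
  by_cases hi1 : i ≤ 2 * δ
  · have := hc.dist_zero i
    have := hc'.dist_zero i
    have := hd.triangle (c i) (c 0) (c' i)
    have := hd.comm (c i) (c 0)
    rw [h0] at *
    omega
  by_cases hi2 : i + 2 * δ + k < n
  · obtain ⟨j, hj⟩ := hT.exists_near_ray hd hc hc' h (i := i) (by rw [h0]; omega) hi2
    have := hc.dist_comp_le hd hc' (i := i) (j := j)
    rw [h0] at this
    omega
  · have h1 := hc i (n - i)
    have h2 := hc' i (n - i)
    rw [Nat.add_sub_cancel' hi] at h1 h2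
    have := hd.triangle (c i) (c n) (c' i)
    have := hd.triangle (c n) (c' n) (c' i)
    have := hd.comm (c' n) (c' i)
    omega

/-- Quasigeodesic rays are uniformly close to geodesic rays. -/
theorem ThinIntervals.exists_ray_near_biLip (hd : IsGeodesicMetric d) (hT : ThinIntervals d δ)
    (hfin : ∀ x n, {y | d x y ≤ n}.Finite) (A : ℕ) :
    ∃ R, ∀ q, BiLip d A q → ∃ c, IsRay d c ∧ c 0 = q 0 ∧
      (∀ i, ∃ j, d (c i) (q j) ≤ R) ∧ ∀ j, ∃ i, d (c i) (q j) ≤ R := by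
  obtain ⟨D, hD⟩ := hT.exists_geodesic_near_biLip hd A
  obtain ⟨R, hR⟩ := hT.exists_biLip_near_geodesic hd A
  refine ⟨max D R, fun q hq => ?_⟩
  -- The ray is a limit of geodesics from `q 0` to `q n`. Balls are finite, so along a nonprincipal
  -- ultrafilter every position `g n i` is eventually constant in `n`.
  choose g g0 g1 hg using fun n => hd.exists_geodesic (q 0) (q n)
  have hlen : ∀ i, ∀ᶠ n in (hyperfilter ℕ : Filter ℕ), i ≤ d (q 0) (q n) := by
    intro i
    have : ∀ᶠ n in atTop, i ≤ d (q 0) (q n) := by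
      filter_upwards [eventually_gt_atTop (A * i)] with n hn
      have h := (hq 0 n).2
      rw [Nat.zero_add] at h
      exact (lt_of_mul_lt_mul_left (hn.trans_le h) (Nat.zero_le _)).le
    exact (Nat.hyperfilter_le_atTop) this
  have hlim : ∀ i, ∃ v, ∀ᶠ n in (hyperfilter ℕ : Filter ℕ), g n i = v := by
    intro i
    have h1 : ∀ᶠ n in (hyperfilter ℕ : Filter ℕ), ∃ v ∈ {y | d (q 0) y ≤ i}, g n i = v := by
      filter_upwards [hlen i] with n hn
      refine ⟨_, ?_, rfl⟩
      have := hg n 0 i (by omega)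
      rw [Nat.zero_add, g0] at this
      exact this.le
    obtain ⟨v, -, hv⟩ := (Ultrafilter.eventually_exists_mem_iff (hfin _ _)).1 h1
    exact ⟨v, hv⟩
  choose c hc using hlim
  have hcB : ∀ B, ∀ᶠ n in (hyperfilter ℕ : Filter ℕ), ∀ i ≤ B, g n i = c i := by
    intro B
    have := (eventually_all_finite (Set.finite_Iic B)).2 fun i _ => hc i
    simpa using this
  have hc0 : c 0 = q 0 := by
    obtain ⟨n, hn⟩ := (hc 0).exists
    rw [← hn, g0]
  have hray : IsRay d c := by
    intro i m
    obtain ⟨n, h1, h2, h3⟩ := ((hc i).and ((hc (i + m)).and (hlen (i + m)))).exists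
    rw [← h1, ← h2, hg n i m h3]
  refine ⟨c, hray, hc0, fun i => ?_, fun j => ?_⟩
  · obtain ⟨n, h1, h2⟩ := ((hc i).and (hlen i)).exists
    have hbet := between_of_geodesic (g0 n) (g1 n) (hg n) h2
    obtain ⟨j, -, -, hj⟩ := hD q 0 n (Nat.zero_le _) (hq.biLipOn _ _) _ hbet
    exact ⟨j, h1 ▸ hj.trans (le_max_left _ _)⟩
  · obtain ⟨n, h1, h2⟩ := ((hcB (R + A * j)).and
      (Nat.hyperfilter_le_atTop (eventually_ge_atTop j))).exists
    obtain ⟨i, hi, hij⟩ := hR q 0 n (hq.biLipOn _ _) (g n) (g0 n) (g1 n) (hg n) j (Nat.zero_le _) h2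
    have e1 := hg n 0 i (by omega)
    have e2 := (hq 0 j).1
    rw [Nat.zero_add] at e1 e2
    rw [g0] at e1
    have := hd.triangle (q 0) (q j) (g n i)
    have := hd.comm (q j) (g n i)
    exact ⟨i, by rw [← h1 i (by omega)]; exact hij.trans (le_max_right _ _)⟩

/-- Since `q j` leaves every ball, the indices at which `c` is near `q j` are unbounded; closeness
to `q` infinitely often thus passes to `c`. -/
theorem BiLip.frequently_of_near {q : ℕ → V} (hd : IsGeodesicMetric d) (hq : BiLip d A q)
    {c c' : ℕ → V} (hc : IsRay d c) (hc0 : c 0 = q 0) {R H : ℕ}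
    (hnear : ∀ j, ∃ i, d (c i) (q j) ≤ R) (h : ∃ᶠ j in atTop, ∃ i, d (c' i) (q j) ≤ H) :
    ∃ᶠ i in atTop, ∃ j, d (c i) (c' j) ≤ R + H := by
  rw [frequently_atTop]
  intro B
  obtain ⟨j, hj, i', hi'⟩ := frequently_atTop.1 h (A * (B + R) + 1)
  obtain ⟨i, hi⟩ := hnear j
  have h1 := (hq 0 j).2
  rw [Nat.zero_add] at h1
  have h2 : B + R < d (q 0) (q j) :=
    lt_of_mul_lt_mul_left (lt_of_lt_of_le (by omega) h1) (Nat.zero_le A)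
  have h3 := hc.dist_zero i
  rw [hc0] at h3
  have := hd.triangle (q 0) (c i) (q j)
  have := hd.triangle (c i) (q j) (c' i')
  have := hd.comm (q j) (c' i')
  exact ⟨i, by omega, i', by omega⟩

/-- A quasigeodesic ray that comes close to a geodesic ray infinitely often is uniformly close to
it. -/
theorem ThinIntervals.exists_forall_near_biLip (hd : IsGeodesicMetric d)
    (hT : ThinIntervals d δ) (hfin : ∀ x n, {y | d x y ≤ n}.Finite) (A : ℕ) :
    ∃ R, ∀ q c, BiLip d A q → IsRay d c → ∀ H, (∃ᶠ j in atTop, ∃ i, d (c i) (q j) ≤ H) →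
      (∀ i, ∃ j, d (c i) (q j) ≤ R + 3 * d (q 0) (c 0)) ∧
      ∀ j, ∃ i, d (c i) (q j) ≤ R + 3 * d (q 0) (c 0) := by
  obtain ⟨R, hR⟩ := hT.exists_ray_near_biLip hd hfin A
  refine ⟨R + 8 * δ, fun q c hq hc H hH => ?_⟩
  obtain ⟨γ, hγ, hγ0, h1, h2⟩ := hR q hq
  have hfreq := hq.frequently_of_near hd hγ hγ0 h2 hH
  have key := hT.dist_ray_le hd hγ hc hfreq
  rw [hγ0] at key
  constructor
  · intro i
    obtain ⟨j, hj⟩ := h1 i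
    have := key i
    have := hd.triangle (c i) (γ i) (q j)
    have := hd.comm (c i) (γ i)
    exact ⟨j, by omega⟩
  · intro j
    obtain ⟨i, hi⟩ := h2 j
    have := key i
    have := hd.triangle (c i) (γ i) (q j)
    have := hd.comm (c i) (γ i)
    exact ⟨i, by omega⟩

/-- Every ray is asymptotic to a ray from a given point. -/
theorem ThinIntervals.exists_asymptotic_ray (hd : IsGeodesicMetric d) (hT : ThinIntervals d δ)
    (hfin : ∀ x n, {y | d x y ≤ n}.Finite) {c : ℕ → V} (hc : IsRay d c) (x : V) :
    ∃ c', IsRay d c' ∧ c' 0 = x ∧ ∃ H, ∃ᶠ i in atTop, ∃ j, d (c' i) (c j) ≤ H := by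
  let e := d x (c 0)
  -- Jumping from `x` to `c` only after time `e = d x (c 0)` ensures `d x (c (e + i)) ≥ i`, so that
  -- `q` is bi-Lipschitz.
  let q : ℕ → V := fun i => if i = 0 then x else c (e + i)
  have hx : ∀ i, i ≤ d x (c (e + i)) ∧ d x (c (e + i)) ≤ e + (e + i) := by
    intro i
    have := hc.dist_zero (e + i)
    have h1 := hd.triangle (c 0) x (c (e + i))
    have h2 := hd.triangle x (c 0) (c (e + i))
    rw [hd.comm (c 0) x] at h1
    change _ ≤ e + _ at h1
    change _ ≤ e + _ at h2
    omega
  have hq : BiLip d (2 * e + 1) q := by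
    intro i m
    rcases Nat.eq_zero_or_pos m with rfl | hm
    · simp [hd.self]
    have hm' : e * 1 ≤ e * m := Nat.mul_le_mul_left _ hm
    rcases Nat.eq_zero_or_pos i with rfl | hi
    · simp only [q, Nat.zero_add, if_true, if_neg hm.ne']
      have := hx m
      constructor
      · rw [add_mul, mul_assoc]; omega
      · rw [add_mul]; exact this.1.trans (by omega)
    · simp only [q, if_neg hi.ne', if_neg (by omega : ¬ i + m = 0)]
      rw [← add_assoc, hc, add_mul]
      omega
  obtain ⟨R, hR⟩ := hT.exists_ray_near_biLip hd hfin (2 * e + 1)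
  obtain ⟨γ, hγ, hγ0, h1, h2⟩ := hR q hq
  refine ⟨γ, hγ, by simp [hγ0, q], R + 0, hq.frequently_of_near hd hγ hγ0 h2 ?_⟩
  refine (eventually_gt_atTop 0).frequently.mono fun j hj => ⟨e + j, ?_⟩
  simp only [q, if_neg (ne_of_gt hj), hd.self, le_refl]

end Rays

/-! ### Word metrics -/

section WordMetric

variable {Γ : Type*} [Group Γ] {S : Set Γ}

theorem dist_mul_left (S : Set Γ) (g u v : Γ) :
    (cayley S).dist (g * u) (g * v) = (cayley S).dist u v := by
  simp only [SimpleGraph.dist, edist_mul_left]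

theorem cayley_reachable_mul {s : Γ} (hs : s ∈ S) (g : Γ) : (cayley S).Reachable g (g * s) := by
  by_cases h : g = g * s
  · rw [← h]
  · exact ((SimpleGraph.mulCayley_adj' S g (g * s)).2 ⟨h, s, hs, Or.inl rfl⟩).reachable

theorem connected_cayley (hS : Subgroup.closure S = ⊤) : (cayley S).Connected := by
  have key : ∀ g : Γ, ∀ u : Γ, (cayley S).Reachable u (u * g) := by
    intro g
    have hg : g ∈ Subgroup.closure S := hS ▸ Subgroup.mem_top g
    induction hg using Subgroup.closure_induction with
    | mem s hs => exact cayley_reachable_mul hs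
    | one => intro u; rw [mul_one]
    | mul a b _ _ ha hb => intro u; rw [← mul_assoc]; exact (ha u).trans (hb _)
    | inv a _ ha =>
      intro u
      have := ha (u * a⁻¹)
      rw [inv_mul_cancel_right] at this
      exact this.symm
  exact ⟨fun u v => by simpa using key (u⁻¹ * v) u⟩

theorem finite_ball_cayley (hfin : S.Finite) (hS : Subgroup.closure S = ⊤) (x : Γ) (n : ℕ) :
    {y | (cayley S).dist x y ≤ n}.Finite := by
  have hconn := connected_cayley hS
  have hd := isGeodesicMetric_dist hconn
  induction n with
  | zero =>
    refine (Set.finite_singleton x).subset fun y hy => ?_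
    exact (hd.eq_of_eq_zero (Nat.le_zero.1 hy)).symm
  | succ n ih =>
    have hnb : ∀ p, {y | (cayley S).Adj p y}.Finite := by
      intro p
      refine ((hfin.image (fun s => p * s)).union (hfin.image (fun s => p * s⁻¹))).subset ?_
      intro y hy
      obtain ⟨-, s, hs, h | h⟩ := (SimpleGraph.mulCayley_adj' S p y).1 hy
      · exact Or.inl ⟨s, hs, h⟩
      · exact Or.inr ⟨s, hs, by simp [h]⟩
    refine (ih.union (ih.biUnion fun p _ => hnb p)).subset fun y hy => ?_
    rcases Nat.lt_or_ge n ((cayley S).dist x y) with h | h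
    · obtain ⟨p, hp, hp'⟩ := exists_between hd x y n h.le
      refine Or.inr (mem_biUnion (x := p) (show _ ≤ n from hp'.le) ?_)
      change (cayley S).Adj p y
      refine SimpleGraph.dist_eq_one_iff_adj.1 ?_
      have : (cayley S).dist x y ≤ n + 1 := hy
      unfold Between at hp
      omega
    · exact Or.inl h

/-- Word metrics of finite generating sets are bi-Lipschitz equivalent. -/
theorem exists_dist_cayley_le {S' : Set Γ} (hS : Subgroup.closure S = ⊤) (hfin : S'.Finite)
    (hS' : Subgroup.closure S' = ⊤) :
    ∃ B, ∀ x y, (cayley S).dist x y ≤ B * (cayley S').dist x y := by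
  have hd := isGeodesicMetric_dist (connected_cayley hS)
  obtain ⟨B, hB⟩ := (hfin.image (fun s => (cayley S).dist 1 s)).bddAbove
  refine ⟨B, fun x y => ?_⟩
  obtain ⟨p, hp⟩ := (connected_cayley hS').exists_walk_length_eq_dist x y
  rw [← hp]
  clear hp
  induction p with
  | nil => simp
  | @cons u v w h p ih =>
    have h1 : (cayley S).dist u v ≤ B := by
      obtain ⟨-, s, hs, h | h⟩ := (SimpleGraph.mulCayley_adj' S' u v).1 h
      · have := dist_mul_left S u 1 s
        rw [mul_one, h] at this
        exact this ▸ hB ⟨s, hs, rfl⟩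
      · have := dist_mul_left S v 1 s
        rw [mul_one, ← h, SimpleGraph.dist_comm] at this
        exact this ▸ hB ⟨s, hs, rfl⟩
    have := hd.triangle u v w
    rw [SimpleGraph.Walk.length_cons, mul_add]
    omega

/-- The Cayley graph of `S` is connected and locally finite, with thin triangles. -/
structure IsHyperbolicCayley (S : Set Γ) (δ : ℕ) : Prop where
  connected : (cayley S).Connected
  thin : ThinIntervals (cayley S).dist δ
  finite_ball : ∀ x n, {y | (cayley S).dist x y ≤ n}.Finite

theorem IsHyperbolicGroup.exists_isHyperbolicCayley (h : IsHyperbolicGroup Γ) (hfin : S.Finite)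
    (hS : Subgroup.closure S = ⊤) : ∃ δ, IsHyperbolicCayley S δ := by
  obtain ⟨S', hfin', hS', δ', hδ'⟩ := h
  have hc := connected_cayley hS
  have hc' := connected_cayley hS'
  obtain ⟨B, hB⟩ := exists_dist_cayley_le hS hfin' hS'
  obtain ⟨B', hB'⟩ := exists_dist_cayley_le hS' hfin hS
  obtain ⟨δ, hδ⟩ := (hδ'.thinIntervals hc').of_biLip (isGeodesicMetric_dist hc')
    (isGeodesicMetric_dist hc) (max B B')
    (fun x y => (hB x y).trans (Nat.mul_le_mul_right _ (le_max_left _ _)))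
    (fun x y => (hB' x y).trans (Nat.mul_le_mul_right _ (le_max_right _ _)))
  exact ⟨δ, hc, hδ, finite_ball_cayley hfin hS⟩

end WordMetric

/-! ### The Gromov boundary of a hyperbolic group -/

section Boundary

variable {Γ : Type*} [Group Γ] {S : Set Γ} {δ A : ℕ}

theorem BiLip.isQuasigeodesicRay {q : ℕ → Γ} (hq : BiLip (cayley S).dist A q) :
    IsQuasigeodesicRay (cayley S) q := by
  have hA : 1 ≤ A := by
    have := (hq 0 1).2
    by_contra! h
    simp [Nat.lt_one_iff.1 h] at this
  have hA' : (1 : ℝ) ≤ A := by exact_mod_cast hA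
  have key : ∀ i j : ℕ, i ≤ j → 1 / (A : ℝ) * |(i : ℝ) - j| - 0 ≤ ((cayley S).dist (q i) (q j) : ℝ) ∧
      ((cayley S).dist (q i) (q j) : ℝ) ≤ A * |(i : ℝ) - j| + 0 := by
    intro i j hij
    obtain ⟨m, rfl⟩ := Nat.exists_eq_add_of_le hij
    obtain ⟨h1, h2⟩ := hq i m
    have e : |(i : ℝ) - ((i + m : ℕ) : ℝ)| = m := by
      push_cast
      rw [show (i : ℝ) - (i + m) = -m by ring, abs_neg, abs_of_nonneg (Nat.cast_nonneg m)]
    rw [e, sub_zero, add_zero, one_div, inv_mul_le_iff₀ (by linarith)]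
    exact ⟨by exact_mod_cast h2, by exact_mod_cast h1⟩
  refine ⟨A, 0, hA', le_rfl, fun i j => ?_⟩
  rcases le_total i j with h | h
  · exact key i j h
  · have := key j i h
    rwa [abs_sub_comm, SimpleGraph.dist_comm] at this

namespace IsHyperbolicCayley

variable (H : IsHyperbolicCayley S δ)

include H

theorem metric : IsGeodesicMetric (cayley S).dist := isGeodesicMetric_dist H.connected

theorem isRay (c : GeodesicRay S) : IsRay (cayley S).dist c.1 :=
  fun i m => (edist_eq_coe_iff H.connected).1 (c.2 i m)

theorem exists_geodesicRay {c : ℕ → Γ} (hc : IsRay (cayley S).dist c) :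
    ∃ r : GeodesicRay S, r.1 = c :=
  ⟨⟨c, fun i m => (edist_eq_coe_iff H.connected).2 (hc i m)⟩, rfl⟩

theorem endpoint_eq_of_forall_dist_le {c c' : GeodesicRay S} {k : ℕ}
    (h : ∀ i, (cayley S).dist (c.1 i) (c'.1 i) ≤ k) : c.endpoint = c'.endpoint := by
  refine Quotient.sound ⟨k, ?_, ?_⟩
  · rintro _ ⟨i, rfl⟩
    exact ⟨_, ⟨i, rfl⟩, (edist_le_coe_iff H.connected).2 (h i)⟩
  · rintro _ ⟨i, rfl⟩
    exact ⟨_, ⟨i, rfl⟩, (edist_le_coe_iff H.connected).2 (h i)⟩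

theorem endpoint_eq_of_frequently {c c' : GeodesicRay S} {k : ℕ}
    (h : ∃ᶠ i in atTop, ∃ j, (cayley S).dist (c.1 i) (c'.1 j) ≤ k) : c.endpoint = c'.endpoint :=
  H.endpoint_eq_of_forall_dist_le (H.thin.dist_ray_le H.metric (H.isRay c) (H.isRay c') h)

theorem exists_near_of_endpoint_eq {c c' : GeodesicRay S} (h : c.endpoint = c'.endpoint) :
    ∃ k, ∀ i, ∃ j, (cayley S).dist (c.1 i) (c'.1 j) ≤ k := by
  obtain ⟨k, hk, -⟩ := Quotient.exact h
  refine ⟨k, fun i => ?_⟩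
  obtain ⟨_, ⟨j, rfl⟩, hj⟩ := hk _ ⟨i, rfl⟩
  exact ⟨j, (edist_le_coe_iff H.connected).1 hj⟩

theorem dist_le_of_endpoint_eq {c c' : GeodesicRay S} (h : c.endpoint = c'.endpoint) (i : ℕ) :
    (cayley S).dist (c.1 i) (c'.1 i) ≤ 8 * δ + 3 * (cayley S).dist (c.1 0) (c'.1 0) := by
  obtain ⟨k, hk⟩ := H.exists_near_of_endpoint_eq h
  exact H.thin.dist_ray_le H.metric (H.isRay c) (H.isRay c')
    (Eventually.of_forall hk).frequently i

theorem exists_ray_from (ξ : GromovBoundary S) (x : Γ) :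
    ∃ c : GeodesicRay S, c.1 0 = x ∧ c.endpoint = ξ := by
  induction ξ using Quotient.inductionOn with
  | _ c =>
    obtain ⟨c', hc', h0, k, hk⟩ :=
      H.thin.exists_asymptotic_ray H.metric H.finite_ball (H.isRay c) x
    obtain ⟨r, rfl⟩ := H.exists_geodesicRay hc'
    exact ⟨r, h0, H.endpoint_eq_of_frequently hk⟩

theorem represents_of_frequently {q : ℕ → Γ} (hq : BiLip (cayley S).dist A q)
    (c : GeodesicRay S) {k : ℕ}
    (h : ∃ᶠ j in atTop, ∃ i, (cayley S).dist (c.1 i) (q j) ≤ k) : Represents S q c.endpoint := by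
  obtain ⟨R, hR⟩ := H.thin.exists_forall_near_biLip H.metric H.finite_ball A
  obtain ⟨h1, h2⟩ := hR q c.1 hq (H.isRay c) k h
  refine ⟨hq.isQuasigeodesicRay, c, rfl, R + 3 * (cayley S).dist (q 0) (c.1 0), ?_, ?_⟩
  · rintro _ ⟨j, rfl⟩
    obtain ⟨i, hi⟩ := h2 j
    rw [SimpleGraph.dist_comm] at hi
    exact ⟨_, ⟨i, rfl⟩, (edist_le_coe_iff H.connected).2 hi⟩
  · rintro _ ⟨i, rfl⟩
    obtain ⟨j, hj⟩ := h1 i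
    rw [SimpleGraph.dist_comm] at hj
    exact ⟨_, ⟨j, rfl⟩, (edist_le_coe_iff H.connected).2 hj⟩

theorem exists_represents {q : ℕ → Γ} (hq : BiLip (cayley S).dist A q) :
    ∃ ξ, Represents S q ξ := by
  obtain ⟨R, hR⟩ := H.thin.exists_ray_near_biLip H.metric H.finite_ball A
  obtain ⟨c, hc, -, -, h⟩ := hR q hq
  obtain ⟨r, rfl⟩ := H.exists_geodesicRay hc
  exact ⟨_, H.represents_of_frequently hq r (Eventually.of_forall h).frequently⟩

theorem exists_near_of_represents {q : ℕ → Γ} {ξ : GromovBoundary S} (hq : Represents S q ξ) :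
    ∃ r : GeodesicRay S, r.endpoint = ξ ∧
      ∃ k, ∀ j, ∃ i, (cayley S).dist (r.1 i) (q j) ≤ k := by
  obtain ⟨-, r, hr, k, hk, -⟩ := hq
  refine ⟨r, hr, k, fun j => ?_⟩
  obtain ⟨_, ⟨i, rfl⟩, hi⟩ := hk _ ⟨j, rfl⟩
  rw [edist_le_coe_iff H.connected, SimpleGraph.dist_comm] at hi
  exact ⟨i, hi⟩

/-- The geodesic ray that shadows `q` is asymptotic to representatives of both classes. Closeness
along a sequence of times suffices, which is all that `≈` provides. -/
theorem eq_of_represents_of_frequently {q q' : ℕ → Γ} (hq : BiLip (cayley S).dist A q)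
    {ξ ξ' : GromovBoundary S} (hξ : Represents S q ξ) (hξ' : Represents S q' ξ') {k : ℕ}
    (h : ∃ᶠ j in atTop, ∃ i, (cayley S).dist (q j) (q' i) ≤ k) : ξ = ξ' := by
  obtain ⟨R, hR⟩ := H.thin.exists_ray_near_biLip H.metric H.finite_ball A
  obtain ⟨c, hc, hc0, -, hcq⟩ := hR q hq
  obtain ⟨γ, rfl⟩ := H.exists_geodesicRay hc
  obtain ⟨r, rfl, m, hm⟩ := H.exists_near_of_represents hξ
  obtain ⟨r', rfl, m', hm'⟩ := H.exists_near_of_represents hξ'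
  have h1 : γ.endpoint = r.endpoint := H.endpoint_eq_of_frequently
    (hq.frequently_of_near H.metric hc hc0 hcq (Eventually.of_forall hm).frequently)
  have h2 : γ.endpoint = r'.endpoint := by
    refine H.endpoint_eq_of_frequently
      (hq.frequently_of_near H.metric hc hc0 hcq (H := m' + k) (h.mono fun j ⟨i, hi⟩ => ?_))
    obtain ⟨l, hl⟩ := hm' i
    refine ⟨l, (H.metric.triangle _ (q' i) _).trans (add_le_add hl ?_)⟩
    rwa [SimpleGraph.dist_comm]
  rw [← h1, h2]

theorem represents_unique {q : ℕ → Γ} (hq : BiLip (cayley S).dist A q)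
    {ξ ξ' : GromovBoundary S} (hξ : Represents S q ξ) (hξ' : Represents S q ξ') : ξ = ξ' :=
  H.eq_of_represents_of_frequently hq hξ hξ' (k := 0)
    (Eventually.of_forall fun j => ⟨j, by simp⟩).frequently

theorem mem_shadow_iff {c₀ : GeodesicRay S} {k n : ℕ} {ξ : GromovBoundary S} :
    ξ ∈ shadow S k c₀ n ↔ ∃ c : GeodesicRay S, c.1 0 = 1 ∧ c.endpoint = ξ ∧
      (cayley S).dist (c.1 n) (c₀.1 n) < k := by
  simp only [shadow, mem_ofPred_eq, edist_lt_coe_iff H.connected]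

/-- Rays from `1` that are `k`-close at time `n` are close at all earlier times (`8 δ + 3 k`);
changing the representative costs another `8 δ`. -/
theorem dist_le_of_mem_shadow {c₀ c : GeodesicRay S} (h0 : c₀.1 0 = 1) (hc : c.1 0 = 1) {k n : ℕ}
    (h : c.endpoint ∈ shadow S k c₀ n) {i : ℕ} (hi : i ≤ n) :
    (cayley S).dist (c.1 i) (c₀.1 i) ≤ 16 * δ + 3 * k := by
  obtain ⟨c', hc'0, hc', hk⟩ := H.mem_shadow_iff.1 h
  have h1 := H.thin.dist_ray_le_of_dist_le H.metric (H.isRay c') (H.isRay c₀)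
    (hc'0.trans h0.symm) hk.le hi
  have h2 := H.dist_le_of_endpoint_eq hc'.symm i
  rw [hc, hc'0, H.metric.self] at h2
  have := H.metric.triangle (c.1 i) (c'.1 i) (c₀.1 i)
  omega

theorem continuous_smul (g : Γ) : Continuous fun ξ : GromovBoundary S => g • ξ := by
  refine continuous_def.2 fun U hU => ?_
  intro c₀ h0 hm k
  obtain ⟨c₁, h1, hc₁⟩ := H.exists_ray_from (g • c₀.endpoint) 1
  have hmem : c₁.endpoint ∈ U := hc₁ ▸ hm
  -- Translated rays start at `g`. Replacing one by an asymptotic ray from `1` costs `8 δ + e`, and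
  -- this is done twice.
  let e := 3 * (cayley S).dist 1 g
  filter_upwards [hU c₁ h1 hmem (16 * δ + 2 * e + k)] with n hn ξ hξ
  obtain ⟨c, hc0, hc, hck⟩ := H.mem_shadow_iff.1 hξ
  refine hn (H.mem_shadow_iff.2 ?_)
  obtain ⟨c', hc'0, hc'⟩ := H.exists_ray_from (g • ξ) 1
  refine ⟨c', hc'0, hc', ?_⟩
  have e1 := H.dist_le_of_endpoint_eq (c := c') (c' := c.translate g)
    (by rw [hc', ← hc]; rfl) n
  have e2 := H.dist_le_of_endpoint_eq (c := c₁) (c' := c₀.translate g) (by rw [hc₁]; rfl) n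
  have e3 : (cayley S).dist ((c.translate g).1 n) ((c₀.translate g).1 n) < k := by
    change (cayley S).dist (g * c.1 n) (g * c₀.1 n) < k
    rwa [dist_mul_left]
  have t0 : (c.translate g).1 0 = g := by
    change g * c.1 0 = g
    rw [hc0, mul_one]
  have t1 : (c₀.translate g).1 0 = g := by
    change g * c₀.1 0 = g
    rw [h0, mul_one]
  rw [hc'0, t0] at e1
  rw [h1, t1] at e2
  have := H.metric.triangle (c'.1 n) ((c.translate g).1 n) (c₁.1 n)
  have := H.metric.triangle ((c.translate g).1 n) ((c₀.translate g).1 n) (c₁.1 n)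
  have := H.metric.comm (c₁.1 n) ((c₀.translate g).1 n)
  omega

/-- If `a ≠ b` and `r` is a geodesic ray from `1`, then the translate by `r n` of `a` or of `b` lies
in a shadow of `r` at time `n`, of a size that does not depend on `n`. -/
theorem exists_smul_mem_shadow {a b : GromovBoundary S} (hab : a ≠ b) :
    ∃ k, ∀ r : GeodesicRay S, r.1 0 = 1 → ∀ n,
      r.1 n • a ∈ shadow S k r n ∨ r.1 n • b ∈ shadow S k r n := by
  obtain ⟨ca, ha0, ha⟩ := H.exists_ray_from a 1
  obtain ⟨cb, hb0, hb⟩ := H.exists_ray_from b 1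
  -- If both translates followed `r` back towards `1` up to time `D`, their points at time `D` would
  -- be `12 δ`-close: `2 δ` each to reach the geodesic, `2 δ` each to reach `r`, and `4 δ` along
  -- `r`.
  obtain ⟨D, hD⟩ : ∃ D, 12 * δ < (cayley S).dist (ca.1 D) (cb.1 D) := by
    by_contra! h
    exact hab (ha ▸ hb ▸ H.endpoint_eq_of_forall_dist_le h)
  refine ⟨2 * (D + 4 * δ) + 1, fun r hr0 n => ?_⟩
  -- a ray that does not fellow-travel back along `r` is in the shadow
  have key : ∀ c : GeodesicRay S, c.1 0 = 1 →
      (∀ q, Between (cayley S).dist (r.1 n) q 1 →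
        2 * δ < (cayley S).dist (r.1 n * c.1 D) q) →
      r.1 n • c.endpoint ∈ shadow S (2 * (D + 4 * δ) + 1) r n := by
    intro c hc0 hfar
    obtain ⟨c', hc'0, hc'⟩ := H.exists_ray_from (r.1 n • c.endpoint) 1
    have hr := H.isRay r
    have hcr := H.isRay c'
    have htr := H.isRay (c.translate (r.1 n))
    have t0 : (c.translate (r.1 n)).1 0 = r.1 n := by
      change r.1 n * c.1 0 = r.1 n
      rw [hc0, mul_one]
    have hclose := H.dist_le_of_endpoint_eq (c := c.translate (r.1 n)) (c' := c') hc'.symm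
    obtain ⟨K, hK⟩ : ∃ K, K = 8 * δ + 3 * (cayley S).dist ((c.translate (r.1 n)).1 0) (c'.1 0) :=
      ⟨_, rfl⟩
    rw [← hK] at hclose
    -- So late that the side joining the two asymptotic rays at time `M` is out of reach from time
    -- `D`.
    obtain ⟨M, hM⟩ : ∃ M, M = D + (K + 2 * δ + 1) := ⟨_, rfl⟩
    obtain ⟨q, hq, hq'⟩ := H.thin.quadrilateral H.metric (c'.1 M) (c'.1 0)
      (htr.between (by omega : D ≤ M))
    refine H.mem_shadow_iff.2 ⟨c', hc'0, hc', ?_⟩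
    rcases hq' with hq' | hq' | hq'
    · have h1 := htr D (K + 2 * δ + 1)
      rw [← hM] at h1
      have := H.metric.triangle ((c.translate (r.1 n)).1 D) q ((c.translate (r.1 n)).1 M)
      have := hclose M
      have := H.metric.comm q ((c.translate (r.1 n)).1 M)
      unfold Between at hq'
      omega
    · have h1 := H.thin.exists_near_ray_of_between H.metric hcr (hq'.symm H.metric)
      obtain ⟨j, hj⟩ : ∃ j, j = (cayley S).dist (c'.1 0) q := ⟨_, rfl⟩
      rw [← hj] at h1
      have h2 := htr.dist_zero D
      rw [t0] at h2
      have := H.metric.triangle (r.1 n) ((c.translate (r.1 n)).1 D) (c'.1 j)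
      have := H.metric.triangle ((c.translate (r.1 n)).1 D) q (c'.1 j)
      have h3 := hr.dist_comp_le H.metric hcr (i := n) (j := j)
      rw [hr0, hc'0, H.metric.self] at h3
      rw [H.metric.comm]
      omega
    · rw [t0, hc'0] at hq'
      have := hfar q hq'
      change (cayley S).dist (r.1 n * c.1 D) q ≤ _ at hq
      omega
  by_cases hfa : ∀ q, Between (cayley S).dist (r.1 n) q 1 →
      2 * δ < (cayley S).dist (r.1 n * ca.1 D) q
  · exact Or.inl (ha ▸ key ca ha0 hfa)
  by_cases hfb : ∀ q, Between (cayley S).dist (r.1 n) q 1 →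
      2 * δ < (cayley S).dist (r.1 n * cb.1 D) q
  · exact Or.inr (hb ▸ key cb hb0 hfb)
  -- both rays fellow-travel back along `r`: contradiction
  exfalso
  push Not at hfa hfb
  have hd := H.metric
  obtain ⟨p, hp, hp'⟩ := hfa
  obtain ⟨q, hq, hq'⟩ := hfb
  have ea := (H.isRay ca).dist_zero D
  have eb := (H.isRay cb).dist_zero D
  have da := dist_mul_left S (r.1 n) (ca.1 0) (ca.1 D)
  have db := dist_mul_left S (r.1 n) (cb.1 0) (cb.1 D)
  have dab := dist_mul_left S (r.1 n) (ca.1 D) (cb.1 D)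
  rw [ha0, mul_one, ← ha0, ea] at da
  rw [hb0, mul_one, ← hb0, eb] at db
  have hpn := hd.triangle (r.1 n) p (r.1 n * ca.1 D)
  have hpn' := hd.triangle (r.1 n) (r.1 n * ca.1 D) p
  have hqn := hd.triangle (r.1 n) q (r.1 n * cb.1 D)
  have hqn' := hd.triangle (r.1 n) (r.1 n * cb.1 D) q
  have cp := hd.comm p (r.1 n * ca.1 D)
  have cq := hd.comm q (r.1 n * cb.1 D)
  have hr := H.isRay r
  have hrn := hr.dist_zero n
  have hp1 := hp.symm hd
  have hq1 := hq.symm hd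
  rw [← hr0] at hp1 hq1
  have np := H.thin.exists_near_ray_of_between hd hr hp1
  have nq := H.thin.exists_near_ray_of_between hd hr hq1
  obtain ⟨s, hs⟩ : ∃ s, s = (cayley S).dist (r.1 0) p := ⟨_, rfl⟩
  obtain ⟨t, ht⟩ : ∃ t, t = (cayley S).dist (r.1 0) q := ⟨_, rfl⟩
  have cp' := hd.comm p (r.1 n)
  have cq' := hd.comm q (r.1 n)
  unfold Between at hp1 hq1
  have hst : (cayley S).dist (r.1 s) (r.1 t) ≤ 4 * δ := by
    rcases le_total s t with h | h
    · have := hr s (t - s)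
      rw [Nat.add_sub_cancel' h] at this
      omega
    · have := hr t (s - t)
      rw [Nat.add_sub_cancel' h, hd.comm] at this
      omega
  rw [← hs] at np
  rw [← ht] at nq
  have := hd.triangle (r.1 n * ca.1 D) p (r.1 n * cb.1 D)
  have := hd.triangle p (r.1 s) (r.1 n * cb.1 D)
  have := hd.triangle (r.1 s) (r.1 t) (r.1 n * cb.1 D)
  have := hd.triangle (r.1 t) q (r.1 n * cb.1 D)
  have := hd.comm q (r.1 t)
  omega

end IsHyperbolicCayley

end Boundary

/-! ### Stabilizers of boundary points are virtually cyclic -/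

section Stabilizer

variable {Γ : Type*} [Group Γ] {S : Set Γ} {δ : ℕ}

/-- Far out on the sequence `r`, the element `g` is `k`-close to a shift by `t`. -/
def IsShift (S : Set Γ) (r : ℕ → Γ) (k : ℕ) (g : Γ) (t : ℤ) : Prop :=
  ∀ᶠ i : ℕ in atTop, ∃ j : ℕ, (j : ℤ) = i + t ∧ (cayley S).dist (g * r i) (r j) ≤ k

theorem IsShift.mul (hS : (cayley S).Connected) {r : ℕ → Γ} {k l : ℕ} {g h : Γ} {t u : ℤ}
    (hg : IsShift S r k g t) (hh : IsShift S r l h u) : IsShift S r (k + l) (g * h) (t + u) := by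
  obtain ⟨B, hB⟩ := eventually_atTop.1 hg
  filter_upwards [hh, eventually_ge_atTop (B + u.natAbs)] with i hi hiB
  obtain ⟨j, hj, hj'⟩ := hi
  obtain ⟨m, hm, hm'⟩ := hB j (by omega)
  refine ⟨m, by omega, ?_⟩
  have h1 := dist_mul_left S g (h * r i) (r j)
  have := hS.dist_triangle (u := g * h * r i) (v := g * r j) (w := r m)
  rw [← mul_assoc] at h1
  omega

/-- Together with `IsShift.mul`, this makes the shift a quasimorphism on the stabilizer of the
endpoint. -/
theorem IsShift.dist_le {r : ℕ → Γ} (hr : IsRay (cayley S).dist r) (hS : (cayley S).Connected)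
    {k l : ℕ} {g : Γ} {t u : ℤ} (ht : IsShift S r k g t) (hu : IsShift S r l g u) :
    |t - u| ≤ k + l := by
  obtain ⟨i, ⟨j, hj, hj'⟩, m, hm, hm'⟩ := (ht.and hu).exists
  have h1 := hS.dist_triangle (u := r j) (v := g * r i) (w := r m)
  rw [SimpleGraph.dist_comm (u := r j) (v := g * r i)] at h1
  rw [abs_le]
  rcases le_total j m with h | h
  · have h2 := hr j (m - j)
    rw [Nat.add_sub_cancel' h] at h2
    omega
  · have h2 := hr m (j - m)
    rw [Nat.add_sub_cancel' h, SimpleGraph.dist_comm] at h2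
    omega

theorem IsHyperbolicCayley.exists_isShift (H : IsHyperbolicCayley S δ) (r : GeodesicRay S)
    {g : Γ} (hg : g • r.endpoint = r.endpoint) : ∃ t, IsShift S r.1 (12 * δ) g t := by
  have hd := H.metric
  have hr := H.isRay r
  have hc := H.isRay (r.translate g)
  obtain ⟨k, hk⟩ := H.exists_near_of_endpoint_eq (c := r.translate g) (c' := r) hg
  obtain ⟨e, he⟩ : ∃ e, e = (cayley S).dist ((r.translate g).1 0) (r.1 0) := ⟨_, rfl⟩
  have near : ∀ i, 2 * δ + e < i → ∃ j, (cayley S).dist ((r.translate g).1 i) (r.1 j) ≤ 4 * δ :=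
    fun i hi => H.thin.eventually_near_ray hd hc hr (Eventually.of_forall hk).frequently (he ▸ hi)
  -- One matched pair `(i₀, j₀)` fixes the shift. A later match `j` of `i` differs from `i + j₀ -
  -- i₀` by at most `8 δ`, as both pairs are `4 δ`-close; in all `12 δ`.
  obtain ⟨i₀, hi₀⟩ : ∃ i₀, i₀ = 2 * δ + e + 1 := ⟨_, rfl⟩
  obtain ⟨j₀, hj₀⟩ := near i₀ (by omega)
  refine ⟨j₀ - i₀, ?_⟩
  filter_upwards [eventually_ge_atTop (i₀ + 4 * δ + e + j₀)] with i hi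
  obtain ⟨j, hj⟩ := near i (by omega)
  refine ⟨i + j₀ - i₀, by omega, ?_⟩
  change (cayley S).dist ((r.translate g).1 i) _ ≤ _
  have h1 := hc.dist_zero i
  have h2 := hr.dist_zero j
  have t1 := hd.triangle ((r.translate g).1 0) (r.1 0) ((r.translate g).1 i)
  have t2 := hd.triangle (r.1 0) (r.1 j) ((r.translate g).1 i)
  have c1 := hd.comm (r.1 j) ((r.translate g).1 i)
  have hj0j : j₀ ≤ j := by omega
  have h3 := hr j₀ (j - j₀)
  rw [Nat.add_sub_cancel' hj0j] at h3
  have h4 := hc i₀ (i - i₀)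
  rw [Nat.add_sub_cancel' (by omega)] at h4
  have t3 := hd.triangle ((r.translate g).1 i₀) (r.1 j₀) ((r.translate g).1 i)
  have t4 := hd.triangle (r.1 j₀) (r.1 j) ((r.translate g).1 i)
  have t5 := hd.triangle (r.1 j₀) ((r.translate g).1 i₀) (r.1 j)
  have t6 := hd.triangle ((r.translate g).1 i₀) ((r.translate g).1 i) (r.1 j)
  have c2 := hd.comm (r.1 j₀) ((r.translate g).1 i₀)
  have t7 := hd.triangle ((r.translate g).1 i) (r.1 j) (r.1 (i + j₀ - i₀))
  rcases le_total j (i + j₀ - i₀) with h | h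
  · have h5 := hr j (i + j₀ - i₀ - j)
    rw [Nat.add_sub_cancel' h] at h5
    omega
  · have h5 := hr (i + j₀ - i₀) (j - (i + j₀ - i₀))
    rw [Nat.add_sub_cancel' h, hd.comm] at h5
    omega

/-- Only finitely many elements are close to a shift by a bounded amount. -/
theorem IsHyperbolicCayley.finite_isShift (H : IsHyperbolicCayley S δ) (r : GeodesicRay S)
    (k : ℕ) (T : ℤ) : {g | ∃ t, |t| ≤ T ∧ IsShift S r.1 k g t}.Finite := by
  -- The conjugates of `g` by `r i` eventually lie in one finite ball and so have an ultrafilter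
  -- limit. It determines `g`: two elements with the same limit have equal conjugates at some common
  -- `i`.
  have hlim : ∀ g ∈ {g | ∃ t, |t| ≤ T ∧ IsShift S r.1 k g t},
      ∃ v ∈ {y | (cayley S).dist 1 y ≤ T.toNat + k},
        ∀ᶠ i in (hyperfilter ℕ : Filter ℕ), (r.1 i)⁻¹ * (g * r.1 i) = v := by
    rintro g ⟨t, htT, ht⟩
    refine (Ultrafilter.eventually_exists_mem_iff (H.finite_ball _ _)).1 ?_
    filter_upwards [Nat.hyperfilter_le_atTop ht] with i hi
    obtain ⟨j, hj, hj'⟩ := hi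
    refine ⟨_, ?_, rfl⟩
    have h1 := dist_mul_left S (r.1 i) 1 ((r.1 i)⁻¹ * (g * r.1 i))
    rw [mul_one, mul_inv_cancel_left] at h1
    have h2 := H.metric.triangle (r.1 i) (r.1 j) (g * r.1 i)
    rw [H.metric.comm (r.1 j)] at h2
    have h3 : (cayley S).dist (r.1 i) (r.1 j) ≤ T.toNat := by
      rw [abs_le] at htT
      rcases le_total i j with h | h
      · have h5 := H.isRay r i (j - i)
        rw [Nat.add_sub_cancel' h] at h5
        omega
      · have h5 := H.isRay r j (i - j)
        rw [Nat.add_sub_cancel' h, H.metric.comm] at h5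
        omega
    change (cayley S).dist 1 _ ≤ _
    omega
  choose! f hf hf' using hlim
  refine Set.Finite.of_finite_image ((H.finite_ball 1 (T.toNat + k)).subset
    (image_subset_iff.2 hf)) (f := f) fun g hg h hh hgh => ?_
  obtain ⟨i, h1, h2⟩ := ((hf' g hg).and (hf' h hh)).exists
  rw [hgh, ← h2] at h1
  exact mul_right_cancel (mul_left_cancel h1)

/-- If `γ * p` is the chosen representative of `γ P` and `g ^ n * p ∈ F`, then `γ * p * (g ^ n *
p)⁻¹ = γ * g ^ (-n)`. So pairs in `(Γ ⧸ P) × F` reach all cosets of the powers of `g`. -/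
theorem finiteIndex_zpowers_of_finite {P : Subgroup Γ} [P.FiniteIndex] {g : Γ} {F : Set Γ}
    (hF : F.Finite) (h : ∀ p ∈ P, ∃ n : ℤ, g ^ n * p ∈ F) :
    (Subgroup.zpowers g).FiniteIndex := by
  have := hF.to_subtype
  have hsurj : Function.Surjective (fun x : (Γ ⧸ P) × F =>
      (QuotientGroup.mk (x.1.out * (x.2 : Γ)⁻¹) : Γ ⧸ Subgroup.zpowers g)) := by
    intro y
    obtain ⟨γ, rfl⟩ := QuotientGroup.mk_surjective y
    obtain ⟨p, hp⟩ := QuotientGroup.mk_out_eq_mul P γ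
    obtain ⟨n, hn⟩ := h p p.2
    refine ⟨(QuotientGroup.mk γ, ⟨_, hn⟩), ?_⟩
    rw [QuotientGroup.eq]
    refine ⟨n, ?_⟩
    simp only [hp]
    group
  have : Finite (Γ ⧸ Subgroup.zpowers g) := Finite.of_surjective _ hsurj
  exact Subgroup.finiteIndex_of_finite_quotient

theorem isElementary_of_finite [Finite Γ] : IsElementary Γ :=
  ⟨⊥, inferInstance, inferInstance⟩

/-- A hyperbolic group in which the stabilizer of some boundary point has finite index is
elementary. -/
theorem IsHyperbolicCayley.isElementary_of_finiteIndex_stabilizer (H : IsHyperbolicCayley S δ)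
    (ξ : GromovBoundary S) [(MulAction.stabilizer Γ ξ).FiniteIndex] : IsElementary Γ := by
  obtain ⟨r, -, rfl⟩ := H.exists_ray_from ξ 1
  have hex : ∀ g ∈ MulAction.stabilizer Γ r.endpoint, ∃ t, IsShift S r.1 (12 * δ) g t :=
    fun g hg => H.exists_isShift r hg
  choose! τ hτ using hex
  have hmul : ∀ g ∈ MulAction.stabilizer Γ r.endpoint, ∀ h ∈ MulAction.stabilizer Γ r.endpoint,
      |τ (g * h) - (τ g + τ h)| ≤ 36 * δ := by
    intro g hg h hh
    have := IsShift.dist_le (H.isRay r) H.connected (hτ (g * h) (mul_mem hg hh))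
      ((hτ g hg).mul H.connected (hτ h hh))
    refine this.trans (le_of_eq ?_)
    push_cast
    ring
  by_cases hbig : ∃ g ∈ MulAction.stabilizer Γ r.endpoint, 36 * (δ : ℤ) < τ g
  · obtain ⟨g, hg, hgT⟩ := hbig
    refine ⟨Subgroup.zpowers g, inferInstance,
      finiteIndex_zpowers_of_finite (H.finite_isShift r (12 * δ) (τ g + 36 * δ))
        (P := MulAction.stabilizer Γ r.endpoint) fun h hh => ?_⟩
    have hmem : ∀ n : ℤ, g ^ n * h ∈ MulAction.stabilizer Γ r.endpoint :=
      fun n => mul_mem (zpow_mem hg n) hh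
    -- Multiplying by `g` or `g⁻¹` moves `τ` by `τ g`, up to the defect `36 δ < τ g`. Hence a
    -- minimal `|τ|` is at most `τ g + 36 δ`.
    obtain ⟨n, hmin⟩ : ∃ n : ℤ, ∀ m : ℤ, (τ (g ^ n * h)).natAbs ≤ (τ (g ^ m * h)).natAbs :=
      ⟨_, fun m => Function.argmin_le (fun n : ℤ => (τ (g ^ n * h)).natAbs) m⟩
    refine ⟨n, _, ?_, hτ _ (hmem n)⟩
    have h1 := hmul g hg _ (hmem (n - 1))
    have h2 := hmul g hg _ (hmem n)
    rw [← mul_assoc, ← zpow_one_add] at h1 h2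
    rw [show 1 + (n - 1) = n by ring] at h1
    have h3 := hmin (n - 1)
    have h4 := hmin (1 + n)
    rw [abs_le] at *
    omega
  -- Now `τ ≤ 36 δ` on the stabilizer. Applied to inverses, with `|τ 1| ≤ 36 δ`, this gives `τ ≥
  -- -108 δ`, so the stabilizer is finite.
  · push Not at hbig
    have hfin : Finite (MulAction.stabilizer Γ r.endpoint) := by
      refine Set.Finite.subset (H.finite_isShift r (12 * δ) (108 * δ)) fun g hg =>
        ⟨τ g, ?_, hτ g hg⟩
      have h1 := hmul g hg g⁻¹ (inv_mem hg)
      have h2 := hmul 1 (one_mem _) 1 (one_mem _)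
      rw [mul_inv_cancel] at h1
      rw [mul_one] at h2
      have h3 := hbig g hg
      have h4 := hbig g⁻¹ (inv_mem hg)
      rw [abs_le] at *
      omega
    have : Finite Γ := by
      have := (MulAction.stabilizer Γ r.endpoint).finite_quotient_of_finiteIndex
      exact Finite.of_equiv _ (Subgroup.groupEquivQuotientProdSubgroup
        (s := MulAction.stabilizer Γ r.endpoint)).symm
    exact isElementary_of_finite

end Stabilizer

/-! ### Rays of expansion data are quasigeodesic -/

section Expansion

variable {Γ M ι : Type*} [Group Γ] {D D₀ : Datum Γ M ι}

theorem Datum.ray_add (D : Datum Γ M ι) (α : ℕ → ι) (n i : ℕ) :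
    D.ray α (n + 1 + i) = D.ray α n * D.ray (fun k => α (n + 1 + k)) i := by
  induction i with
  | zero => rfl
  | succ i ih =>
    change D.ray α (n + 1 + i) * _ = _ * (D.ray _ i * _)
    rw [ih, mul_assoc]
    rfl

theorem Datum.ray_congr {α β : ℕ → ι} {n : ℕ} (h : ∀ i ≤ n, D.s (α i) = D₀.s (β i)) :
    D.ray α n = D₀.ray β n := by
  induction n with
  | zero => exact h 0 le_rfl
  | succ n ih =>
    change D.ray α n * _ = D₀.ray β n * _
    rw [ih fun i hi => h i (by omega), h (n + 1) le_rfl]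

section Action

variable [MulAction Γ M]

theorem Datum.point_congr {α β : ℕ → ι} {n : ℕ} (h : ∀ i < n, D.s (α i) = D₀.s (β i)) (x : M) :
    D.point α x n = D₀.point β x n := by
  induction n with
  | zero => rfl
  | succ n ih =>
    change (D.s (α n))⁻¹ • D.point α x n = (D₀.s (β n))⁻¹ • D₀.point β x n
    rw [ih fun i hi => h i (by omega), h n (by omega)]

theorem Datum.point_succ (D : Datum Γ M ι) (α : ℕ → ι) (x : M) (i : ℕ) :
    D.point α x (i + 1) = (D.ray α i)⁻¹ • x := by
  induction i with
  | zero => rfl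
  | succ i ih =>
    change (D.s (α (i + 1)))⁻¹ • D.point α x (i + 1) = (D.ray α i * D.s (α (i + 1)))⁻¹ • x
    rw [ih, mul_inv_rev, mul_smul]

theorem Datum.point_add (D : Datum Γ M ι) (α : ℕ → ι) (x : M) (n i : ℕ) :
    D.point α x (n + i) = D.point (fun k => α (n + k)) (D.point α x n) i := by
  induction i with
  | zero => rfl
  | succ i ih =>
    change (D.s (α (n + i)))⁻¹ • D.point α x (n + i) = _
    rw [ih]
    rfl

theorem Datum.point_mem {Λ : Set M} (hΛinv : ∀ g : Γ, ∀ x ∈ Λ, g • x ∈ Λ) (D : Datum Γ M ι)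
    (α : ℕ → ι) {x : M} (hx : x ∈ Λ) (i : ℕ) : D.point α x i ∈ Λ := by
  cases i with
  | zero => exact hx
  | succ i => rw [D.point_succ]; exact hΛinv _ x hx

variable [MetricSpace M] {Λ : Set M}

/-- Indices are chosen greedily from the Lebesgue property. The ball condition at `i = 0`, not part
of `IsCode`, allows the code to be attached behind other letters. -/
theorem IsExpansionDatum.exists_code (hD : IsExpansionDatum Λ D)
    (hΛinv : ∀ g : Γ, ∀ x ∈ Λ, g • x ∈ Λ) {x : M} (hx : x ∈ Λ) :
    ∃ α : ℕ → ι, (∀ i, α i ∈ D.I) ∧ ∀ i, Metric.ball (D.point α x i) D.δ ⊆ D.U (α i) := by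
  have : Nonempty ι := (hD.lebesgue x hx).nonempty
  choose! a ha ha' using hD.lebesgue
  let p : ℕ → M := fun n => Nat.rec x (fun _ y => (D.s (a y))⁻¹ • y) n
  have hp : ∀ i, D.point (fun i => a (p i)) x i = p i := by
    intro i
    induction i with
    | zero => rfl
    | succ i ih =>
      change (D.s (a (p i)))⁻¹ • D.point _ x i = (D.s (a (p i)))⁻¹ • p i
      rw [ih]
  have hmem : ∀ i, p i ∈ Λ := fun i => hp i ▸ D.point_mem hΛinv _ hx i
  exact ⟨fun i => a (p i), fun i => ha _ (hmem i), fun i => hp i ▸ ha' _ (hmem i)⟩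

/-- Every edge of the walk acts by an `L`-Lipschitz map near `Λ`. The bound is local at `x`, because
the intermediate images of `y` must stay near `Λ`. -/
theorem IsExpansionDatum.eventually_dist_smul_le [ContinuousConstSMul Γ M]
    (hD : IsExpansionDatum Λ D) (hΛinv : ∀ g : Γ, ∀ x ∈ Λ, g • x ∈ Λ) {u v : Γ}
    (w : (cayley D.gens).Walk u v) :
    ∀ x ∈ Λ, ∀ᶠ y in 𝓝 x, dist ((v⁻¹ * u) • x) ((v⁻¹ * u) • y) ≤ D.L ^ w.length * dist x y := by
  induction w with
  | nil => intro x _; simp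
  | @cons u v w h p ih =>
    intro x hx
    have hg : v⁻¹ * u ∈ D.gens := by
      obtain ⟨-, h | h⟩ := (SimpleGraph.mulCayley_adj D.gens u v).1 h
      · simpa using hD.gens_symm _ h
      · exact h
    obtain ⟨α, hα, hs⟩ := hD.gens_symm _ hg
    have hs' : (D.s α)⁻¹ = v⁻¹ * u := by rw [hs, inv_inv]
    have hthick : ∀ᶠ y in 𝓝 x, y ∈ Metric.thickening D.δ Λ :=
      Metric.isOpen_thickening.mem_nhds (Metric.self_subset_thickening hD.δ_pos Λ hx)
    have hcont : Tendsto (fun y : M => (v⁻¹ * u) • y) (𝓝 x) (𝓝 ((v⁻¹ * u) • x)) :=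
      (continuous_const_smul (v⁻¹ * u)).tendsto x
    have hL : 0 ≤ D.L := by linarith [hD.one_lt_lam, hD.lam_le_L]
    filter_upwards [hthick, hcont.eventually (ih _ (hΛinv _ x hx))] with y hy hy'
    have h1 := hD.lipschitz α hα x (Metric.self_subset_thickening hD.δ_pos Λ hx) y hy
    rw [hs'] at h1
    rw [smul_smul, smul_smul, show w⁻¹ * v * (v⁻¹ * u) = w⁻¹ * u by group] at hy'
    rw [SimpleGraph.Walk.length_cons, pow_succ, mul_assoc]
    exact hy'.trans (mul_le_mul_of_nonneg_left h1 (pow_nonneg hL _))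

/-- The matching lower bound: each of the `m` letters after time `i` expands by `λ` near the current
point of the code. -/
theorem IsExpansionDatum.eventually_le_dist_smul [ContinuousConstSMul Γ M]
    (hD : IsExpansionDatum Λ D) {η : ℝ} (hη : 0 < η) {x : M} {α : ℕ → ι} (hα : D.IsCode η x α)
    (i m : ℕ) : ∀ᶠ y in 𝓝 (D.point α x (i + 1)), D.lam ^ m * dist (D.point α x (i + 1)) y ≤
      dist (((D.ray α (i + m))⁻¹ * D.ray α i) • D.point α x (i + 1))
        (((D.ray α (i + m))⁻¹ * D.ray α i) • y) := by
  induction m with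
  | zero => simp
  | succ m ih =>
    let h := (D.ray α (i + m))⁻¹ * D.ray α i
    have hp : h • D.point α x (i + 1) = D.point α x (i + m + 1) := by
      rw [D.point_succ, D.point_succ, smul_smul]
      simp [h]
    have hU : D.U (α (i + m + 1)) ∈ 𝓝 (D.point α x (i + m + 1)) :=
      mem_of_superset (Metric.ball_mem_nhds _ hη) (hα.2 _ (by omega))
    have hcont : Tendsto (fun y : M => h • y) (𝓝 (D.point α x (i + 1)))
        (𝓝 (D.point α x (i + m + 1))) :=
      hp ▸ (continuous_const_smul h).tendsto _
    filter_upwards [ih, hcont.eventually hU] with y hy hy'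
    have h1 := (hD.expanding _ (hα.1 (i + m + 1))).1 _ (mem_of_mem_nhds hU) _ hy'
    have h2 : (D.ray α (i + (m + 1)))⁻¹ * D.ray α i = (D.s (α (i + m + 1)))⁻¹ * h := by
      change (D.ray α (i + m) * D.s (α (i + m + 1)))⁻¹ * _ = _
      rw [mul_inv_rev, mul_assoc]
    rw [h2, mul_smul _ h, mul_smul _ h, pow_succ', mul_assoc]
    refine (mul_le_mul_of_nonneg_left hy (by linarith [hD.one_lt_lam])).trans ?_
    change D.lam * dist (h • D.point α x (i + 1)) (h • y) ≤ _
    rw [hp]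
    exact h1

/-- The rays of an expansion datum are uniformly bi-Lipschitz in the word metric. -/
theorem IsExpansionDatum.exists_biLip [ContinuousConstSMul Γ M]
    (hD : IsExpansionDatum Λ D) (hΛinv : ∀ g : Γ, ∀ x ∈ Λ, g • x ∈ Λ)
    (hΛiso : ∀ x ∈ Λ, (𝓝[≠] x).NeBot) :
    ∃ A, ∀ x ∈ Λ, ∀ η, 0 < η → ∀ α, D.IsCode η x α → BiLip (cayley D.gens).dist A (D.ray α) := by
  obtain ⟨A, hA⟩ := pow_unbounded_of_one_lt D.L hD.one_lt_lam
  have hconn := connected_cayley hD.gens_generate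
  refine ⟨A + 1, fun x hx η hη α hα i m => ⟨?_, ?_⟩⟩
  · suffices h : (cayley D.gens).dist (D.ray α i) (D.ray α (i + m)) ≤ m by
      exact h.trans (Nat.le_mul_of_pos_left _ (Nat.succ_pos _))
    induction m with
    | zero => simp
    | succ m ih =>
      have h1 := hconn.dist_triangle (u := D.ray α i) (v := D.ray α (i + m))
        (w := D.ray α (i + (m + 1)))
      suffices (cayley D.gens).dist (D.ray α (i + m)) (D.ray α (i + (m + 1))) ≤ 1 by omega
      by_cases heq : D.ray α (i + m) = D.ray α (i + (m + 1))
      · rw [heq, SimpleGraph.dist_self]; exact Nat.zero_le _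
      refine (SimpleGraph.dist_eq_one_iff_adj.2 ?_).le
      exact (SimpleGraph.mulCayley_adj' _ _ _).2
        ⟨heq, _, ⟨α (i + m + 1), hα.1 _, rfl⟩, Or.inl rfl⟩
  · obtain ⟨w, hw⟩ := hconn.exists_walk_length_eq_dist (D.ray α i) (D.ray α (i + m))
    rw [← hw]
    have hp : D.point α x (i + 1) ∈ Λ := D.point_mem hΛinv α hx _
    -- A point `y` other than the base point, close enough for both estimates, yields `λ ^ m ≤ L ^ ℓ
    -- ≤ λ ^ (A ℓ)`.
    have := hΛiso _ hp
    obtain ⟨y, ⟨h1, h2⟩, hy⟩ := ((eventually_nhdsWithin_of_eventually_nhds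
      ((hD.eventually_dist_smul_le hΛinv w _ hp).and (hD.eventually_le_dist_smul hη hα i m))).and
      (eventually_mem_nhdsWithin (a := D.point α x (i + 1)) (s := {D.point α x (i + 1)}ᶜ))).exists
    have hpos : 0 < dist (D.point α x (i + 1)) y := dist_pos.2 (Ne.symm hy)
    have h3 : D.lam ^ m ≤ D.L ^ w.length := le_of_mul_le_mul_right (h2.trans h1) hpos
    have hL : 0 ≤ D.L := by linarith [hD.one_lt_lam, hD.lam_le_L]
    have h4 : D.L ^ w.length ≤ D.lam ^ (A * w.length) := by
      rw [pow_mul]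
      exact pow_le_pow_left₀ hL hA.le _
    have h5 := (pow_le_pow_iff_right₀ hD.one_lt_lam).1 (h3.trans h4)
    exact h5.trans (Nat.mul_le_mul_right _ (Nat.le_succ _))

theorem IsExpansionDatum.exists_biLip_cayley [ContinuousConstSMul Γ M]
    (hD : IsExpansionDatum Λ D) (hΛinv : ∀ g : Γ, ∀ x ∈ Λ, g • x ∈ Λ)
    (hΛiso : ∀ x ∈ Λ, (𝓝[≠] x).NeBot) {S : Set Γ} (hSfin : S.Finite)
    (hSgen : Subgroup.closure S = ⊤) :
    ∃ A, ∀ x ∈ Λ, ∀ η, 0 < η → ∀ α, D.IsCode η x α → BiLip (cayley S).dist A (D.ray α) := by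
  obtain ⟨A, hA⟩ := hD.exists_biLip hΛinv hΛiso
  have hfin : D.gens.Finite := D.I.finite_toSet.image _
  obtain ⟨B, hB⟩ := exists_dist_cayley_le hSgen hfin hD.gens_generate
  obtain ⟨B', hB'⟩ := exists_dist_cayley_le hD.gens_generate hSfin hSgen
  refine ⟨max (B * A) (A * B'), fun x hx η hη α hα i m => ?_⟩
  obtain ⟨h1, h2⟩ := hA x hx η hη α hα i m
  constructor
  · refine (hB _ _).trans ((Nat.mul_le_mul_left B h1).trans ?_)
    rw [← mul_assoc]
    exact Nat.mul_le_mul_right _ (le_max_left _ _)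
  · refine h2.trans ((Nat.mul_le_mul_left A (hB' _ _)).trans ?_)
    rw [← mul_assoc]
    exact Nat.mul_le_mul_right _ (le_max_right _ _)

end Action

end Expansion

/-! ### The coding map -/

section Coding

variable {Γ M ι : Type*} [Group Γ] [MetricSpace M] [MulAction Γ M] {S : Set Γ}
  {Λ : Set M} {D₀ D : Datum Γ M ι} {N δ A : ℕ}

theorem Represents.smul {q : ℕ → Γ} {ξ : GromovBoundary S} (h : Represents S q ξ) (g : Γ) :
    Represents S (fun i => g * q i) (g • ξ) := by
  obtain ⟨⟨A, C, hA, hC, hq⟩, r, rfl, n, hn₁, hn₂⟩ := h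
  refine ⟨⟨A, C, hA, hC, fun i j => by rw [dist_mul_left]; exact hq i j⟩, r.translate g, rfl, n,
    ?_, ?_⟩
  · rintro _ ⟨i, rfl⟩
    obtain ⟨_, ⟨j, rfl⟩, hj⟩ := hn₁ _ ⟨i, rfl⟩
    exact ⟨_, ⟨j, rfl⟩, (edist_mul_left S g _ _).trans_le hj⟩
  · rintro _ ⟨i, rfl⟩
    obtain ⟨_, ⟨j, rfl⟩, hj⟩ := hn₂ _ ⟨i, rfl⟩
    exact ⟨_, ⟨j, rfl⟩, (edist_mul_left S g _ _).trans_le hj⟩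

theorem BiLip.mul_left {q : ℕ → Γ} (hq : BiLip (cayley S).dist A q) (g : Γ) :
    BiLip (cayley S).dist A (fun i => g * q i) := by
  intro i m
  rw [dist_mul_left]
  exact hq i m

/-- A meandering-hyperbolic action of a hyperbolic group, together with a thinness constant `δ` of
its Cayley graph and a bi-Lipschitz constant `A` of the rays. -/
structure MeanderingSetup (S : Set Γ) (Λ : Set M) (D₀ D : Datum Γ M ι) (N δ A : ℕ) : Prop where
  hyp : IsHyperbolicCayley S δ
  closure_eq_top : Subgroup.closure S = ⊤
  smul_mem : ∀ g : Γ, ∀ x ∈ Λ, g • x ∈ Λ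
  meandering : IsMeanderingDatum Λ D₀ D N
  biLip : ∀ x ∈ Λ, ∀ η, 0 < η → ∀ α, D.IsCode η x α → BiLip (cayley S).dist A (D.ray α)

theorem Refines.isCode (h : Refines D₀ D) {x : M} {α : ℕ → ι} (hα : D₀.IsCode D₀.δ x α) :
    D.IsCode D.δ x α ∧ D.ray α = D₀.ray α := by
  refine ⟨⟨fun i => h.I_subset (hα.1 i), fun i hi => ?_⟩, funext fun n =>
    Datum.ray_congr fun i _ => (h.s_eq _ (hα.1 i)).symm⟩
  rw [Datum.point_congr (D₀ := D₀) (β := α) fun i _ => (h.s_eq _ (hα.1 i)).symm]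
  exact (Metric.ball_subset_ball h.δ_lt.le).trans ((hα.2 i hi).trans (h.U_subset _ (hα.1 i)))

namespace MeanderingSetup

variable (X : MeanderingSetup S Λ D₀ D N δ A)

include X

theorem exists_code {x : M} (hx : x ∈ Λ) : ∃ α : ℕ → ι, D₀.IsCode D₀.δ x α ∧
    Metric.ball x D₀.δ ⊆ D₀.U (α 0) := by
  obtain ⟨α, h1, h2⟩ := X.meandering.expansion₀.exists_code X.smul_mem hx
  exact ⟨α, ⟨h1, fun i _ => h2 i⟩, h2 0⟩

theorem biLip₀ {x : M} (hx : x ∈ Λ) {α : ℕ → ι} (hα : D₀.IsCode D₀.δ x α) :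
    BiLip (cayley S).dist A (D₀.ray α) := by
  obtain ⟨h1, h2⟩ := X.meandering.refines.isCode hα
  exact h2 ▸ X.biLip x hx D.δ X.meandering.expansion.δ_pos α h1

theorem represents_iff_of_near {x : M} (hx : x ∈ Λ) {c c' : ℕ → Γ} (h : D.Near D.δ N x c c')
    (ξ : GromovBoundary S) : Represents S c ξ ↔ Represents S c' ξ := by
  obtain ⟨⟨α, hα, rfl⟩, ⟨β, hβ, rfl⟩, P, Q, hP, -, hPQ, -⟩ := h
  have hδ := X.meandering.expansion.δ_pos
  have bα := X.biLip x hx _ hδ α hα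
  have bβ := X.biLip x hx _ hδ β hβ
  have hgen := X.meandering.expansion.gens_generate
  obtain ⟨B, hB⟩ := exists_dist_cayley_le X.closure_eq_top (D.I.finite_toSet.image D.s) hgen
  have key : ∀ ξ ξ', Represents S (D.ray α) ξ → Represents S (D.ray β) ξ' → ξ = ξ' := by
    intro ξ ξ' h h'
    refine X.hyp.eq_of_represents_of_frequently bα h h' (k := B * N)
      ((Nat.frequently_atTop_iff_infinite.2 hP).mono fun j hj => ?_)
    obtain ⟨_, ⟨i, -, rfl⟩, hi⟩ := hPQ _ ⟨j, hj, rfl⟩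
    exact ⟨i, (hB _ _).trans (Nat.mul_le_mul_left B
      ((edist_le_coe_iff (connected_cayley hgen)).1 hi))⟩
  obtain ⟨ξα, hξα⟩ := X.hyp.exists_represents bα
  obtain ⟨ξβ, hξβ⟩ := X.hyp.exists_represents bβ
  constructor
  · intro h
    rwa [key ξ ξβ h hξβ]
  · intro h
    rwa [← key ξα ξ hξα h]

theorem exists_isCodingMap : ∃ π : Λ → GromovBoundary S, IsCodingMap S Λ D₀ π := by
  have hex : ∀ x : Λ, ∃ ξ : GromovBoundary S, ∀ c ∈ D₀.Ray D₀.δ (x : M), Represents S c ξ := by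
    rintro ⟨x, hx⟩
    obtain ⟨α, hα, -⟩ := X.exists_code hx
    obtain ⟨ξ, hξ⟩ := X.hyp.exists_represents (X.biLip₀ hx hα)
    refine ⟨ξ, fun c hc => ?_⟩
    -- The intermediate rays of a chain are only `D`-rays, so the bi-Lipschitz bound is needed for
    -- `D` and not just for `D₀`.
    have key : ∀ {c c'}, Relation.EqvGen (D.Near D.δ N x) c c' →
        (Represents S c ξ ↔ Represents S c' ξ) := by
      intro c c' h
      induction h with
      | rel _ _ h => exact X.represents_iff_of_near hx h ξ
      | refl _ => exact Iff.rfl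
      | symm _ _ _ ih => exact ih.symm
      | trans _ _ _ _ _ ih ih' => exact ih.trans ih'
    exact (key (X.meandering.equivalent x hx _ ⟨α, hα, rfl⟩ c hc)).1 hξ
  choose π hπ using hex
  exact ⟨π, hπ⟩

variable {π : Λ → GromovBoundary S} (hπ : IsCodingMap S Λ D₀ π)

include hπ

theorem isCodingMap_unique {π' : Λ → GromovBoundary S} (hπ' : IsCodingMap S Λ D₀ π') :
    π' = π := by
  funext x
  obtain ⟨α, hα, -⟩ := X.exists_code x.2
  exact X.hyp.represents_unique (X.biLip₀ x.2 hα) (hπ' x _ ⟨α, hα, rfl⟩) (hπ x _ ⟨α, hα, rfl⟩)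

/-- The coding map is equivariant. -/
theorem map_smul (g : Γ) (x : Λ) : π ⟨g • (x : M), X.smul_mem g x x.2⟩ = g • π x := by
  have hg : g ∈ Subgroup.closure D₀.gens :=
    X.meandering.expansion₀.gens_generate ▸ Subgroup.mem_top g
  induction hg using Subgroup.closure_induction generalizing x with
  | mem g hg =>
    obtain ⟨b, hb, rfl⟩ := hg
    obtain ⟨x, hx⟩ := x
    obtain ⟨α, hα, hα0⟩ := X.exists_code hx
    -- Prepending `b` to the code of `x` gives a code of `D₀.s b • x`: the first letter is
    -- unconstrained, and the ball condition for `α 0` holds by choice of `α`.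
    let β : ℕ → ι := fun i => Nat.casesOn i b α
    have hpoint : ∀ i, D₀.point β (D₀.s b • x) (1 + i) = D₀.point α x i := by
      intro i
      rw [D₀.point_add β _ 1 i]
      change D₀.point _ ((D₀.s b)⁻¹ • D₀.s b • x) i = _
      rw [inv_smul_smul]
      exact Datum.point_congr (fun j _ => by rw [add_comm]) x
    have hray : ∀ i, D₀.ray β (1 + i) = D₀.s b * D₀.ray α i := by
      intro i
      rw [← Nat.zero_add 1, D₀.ray_add β 0 i]
      change D₀.s b * _ = _
      congr 1
      exact Datum.ray_congr fun j _ => by rw [zero_add, add_comm]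
    have hβ : D₀.IsCode D₀.δ (D₀.s b • x) β := by
      refine ⟨fun i => ?_, fun i hi => ?_⟩
      · cases i with
        | zero => exact hb
        | succ i => exact hα.1 i
      · obtain ⟨i, rfl⟩ := Nat.exists_eq_add_of_le hi
        rw [hpoint, add_comm 1 i]
        change _ ⊆ D₀.U (α i)
        rcases Nat.eq_zero_or_pos i with rfl | hi
        · exact hα0
        · exact hα.2 i hi
    have h1 := (hπ ⟨x, hx⟩ _ ⟨α, hα, rfl⟩).smul (D₀.s b)
    have h2 := hπ ⟨D₀.s b • x, X.smul_mem _ x hx⟩ _ ⟨β, hβ, rfl⟩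
    refine (X.hyp.eq_of_represents_of_frequently ((X.biLip₀ hx hα).mul_left (D₀.s b)) h1 h2
      (k := 0) (Eventually.of_forall fun j => ⟨1 + j, ?_⟩).frequently).symm
    rw [hray, SimpleGraph.dist_self]
  | one =>
    rw [one_smul Γ (π x)]
    congr 1
    exact Subtype.ext (one_smul Γ (x : M))
  | mul g h _ _ hg hh =>
    have h1 := hg ⟨h • (x : M), X.smul_mem h x x.2⟩
    rw [hh] at h1
    rw [mul_smul g h (π x), ← h1]
    congr 1
    exact Subtype.ext (mul_smul g h (x : M))
  | inv g _ hg =>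
    have h1 := hg ⟨g⁻¹ • (x : M), X.smul_mem _ x x.2⟩
    rw [eq_inv_smul_iff, ← h1]
    congr 1
    exact Subtype.ext (smul_inv_smul g (x : M))

/-- On an invariant nonempty set, the coding map takes at least two values. -/
theorem exists_coding_ne (hne : ¬ IsElementary Γ) {K : Set M} (hK : K ⊆ Λ) (hKne : K.Nonempty)
    (hKinv : ∀ g : Γ, ∀ x ∈ K, g • x ∈ K) :
    ∃ x y : K, π (inclusion hK x) ≠ π (inclusion hK y) := by
  by_contra! hcon
  obtain ⟨x, hx⟩ := hKne
  have hstab : MulAction.stabilizer Γ (π ⟨x, hK hx⟩) = ⊤ := by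
    refine (Subgroup.eq_top_iff' _).2 fun g => ?_
    rw [MulAction.mem_stabilizer_iff, ← X.map_smul hπ]
    exact hcon ⟨g • x, hKinv g x hx⟩ ⟨x, hx⟩
  have : (MulAction.stabilizer Γ (π ⟨x, hK hx⟩)).FiniteIndex := by
    rw [hstab]; infer_instance
  exact hne (X.hyp.isElementary_of_finiteIndex_stabilizer (π ⟨x, hK hx⟩))

/-- Points near `x` have rays that fellow-travel with those of `x` for a long time. -/
theorem exists_forall_eventually_dist_le [ContinuousConstSMul Γ M] :
    ∃ k, ∀ x : Λ, ∀ c : GeodesicRay S, c.1 0 = 1 → c.endpoint = π x → ∀ n,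
      ∀ᶠ y in 𝓝 x, ∀ c' : GeodesicRay S, c'.1 0 = 1 → c'.endpoint = π y →
        ∀ m ≤ n, (cayley S).dist (c.1 m) (c'.1 m) ≤ k := by
  have H := X.hyp
  have hd := H.metric
  have hr := X.meandering.refines
  obtain ⟨R, hR⟩ := H.thin.exists_forall_near_biLip hd H.finite_ball A
  -- Coded rays start at a generator rather than at `1`; `E` bounds the discrepancy uniformly in the
  -- point and the code.
  obtain ⟨E, hE⟩ := (D.I.finite_toSet.image (fun α => (cayley S).dist (D.s α) 1)).bddAbove
  have near : ∀ x : Λ, ∀ α, D.IsCode D.δ (x : M) α → Represents S (D.ray α) (π x) →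
      ∀ c : GeodesicRay S, c.1 0 = 1 → c.endpoint = π x →
      (∀ i, ∃ j, (cayley S).dist (c.1 i) (D.ray α j) ≤ R + 3 * E) ∧
        ∀ j, ∃ i, (cayley S).dist (c.1 i) (D.ray α j) ≤ R + 3 * E := by
    intro x α hα hrep c hc0 hc
    obtain ⟨r, hr, k, hk⟩ := H.exists_near_of_represents hrep
    have hclose := H.dist_le_of_endpoint_eq (hc.trans hr.symm)
    have h0 : (cayley S).dist (D.ray α 0) (c.1 0) ≤ E := by
      rw [hc0]; exact hE ⟨α 0, hα.1 0, rfl⟩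
    obtain ⟨h1, h2⟩ := hR _ c.1 (X.biLip x x.2 _ X.meandering.expansion.δ_pos α hα) (H.isRay c)
      (8 * δ + 3 * (cayley S).dist (c.1 0) (r.1 0) + k)
      (Eventually.of_forall fun j => by
        obtain ⟨i, hi⟩ := hk j
        exact ⟨i, (hd.triangle _ _ _).trans (add_le_add (hclose i) hi)⟩).frequently
    exact ⟨fun i => (h1 i).imp fun j hj => by omega, fun j => (h2 j).imp fun i hi => by omega⟩
  obtain ⟨K, hK⟩ : ∃ K, K = R + 3 * E := ⟨_, rfl⟩
  rw [← hK] at near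
  refine ⟨4 * K, fun x c hc0 hc n => ?_⟩
  obtain ⟨α, hα, hα0⟩ := X.exists_code x.2
  obtain ⟨hαD, hαray⟩ := hr.isCode hα
  -- Points of the coded ray that are `K`-close to `c m` with `m ≤ n` occur no later than `J`.
  obtain ⟨J, hJ⟩ : ∃ J, J = A * (E + n + K) := ⟨_, rfl⟩
  have hαα : ∀ i, D.s (α i) = D₀.s (α i) := fun i => (hr.s_eq _ (hα.1 i)).symm
  have hcont : ∀ i, Continuous fun y : M => D.point α y i := by
    intro i
    cases i with
    | zero => exact continuous_id
    | succ i => simpa only [D.point_succ] using continuous_const_smul (D.ray α i)⁻¹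
  -- The slack `δ₀ - δ` puts the `δ`-ball around the point of `y` inside the `δ₀`-ball around that
  -- of `x`.
  have hev : ∀ᶠ y in 𝓝 (x : M), ∀ i ∈ Set.Iic J,
      dist (D.point α y i) (D.point α (x : M) i) < D₀.δ - D.δ := by
    refine (eventually_all_finite (Set.finite_Iic J)).2 fun i _ => ?_
    exact (hcont i).tendsto (x : M) (Metric.ball_mem_nhds _ (sub_pos.2 hr.δ_lt))
  filter_upwards [continuous_subtype_val.continuousAt.eventually hev] with y hy c' hc'0 hc' m hm
  -- follow the code of `x` for a while, and then a code of the point that has been reached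
  have hz : D.point α (y : M) (J + 1) ∈ Λ := D.point_mem X.smul_mem α y.2 _
  obtain ⟨β, hβ, hβ0⟩ := X.exists_code hz
  obtain ⟨hβD, hβray⟩ := hr.isCode hβ
  have hββ : ∀ i, D.s (β i) = D₀.s (β i) := fun i => (hr.s_eq _ (hβ.1 i)).symm
  let γ : ℕ → ι := fun i => if i ≤ J then α i else β (i - (J + 1))
  have hγα : ∀ i ≤ J, γ i = α i := fun i hi => if_pos hi
  have hγβ : ∀ i, γ (J + 1 + i) = β i := fun i => by
    simp only [γ, if_neg (by omega : ¬ J + 1 + i ≤ J), Nat.add_sub_cancel_left]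
  have hpα : ∀ i ≤ J + 1, D.point γ (y : M) i = D.point α (y : M) i := fun i hi =>
    Datum.point_congr (fun j hj => by rw [hγα j (by omega)]) _
  have hpβ : ∀ i, D.point γ (y : M) (J + 1 + i) =
      D.point β (D.point α (y : M) (J + 1)) i := fun i => by
    rw [D.point_add, hpα _ le_rfl]
    exact Datum.point_congr (fun j _ => by rw [hγβ]) _
  have hrα : ∀ i ≤ J, D.ray γ i = D.ray α i := fun i hi =>
    Datum.ray_congr fun j hj => by rw [hγα j (by omega)]
  have hrβ : ∀ i, D.ray γ (J + 1 + i) = D.ray α J * D.ray β i := fun i => by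
    rw [D.ray_add, hrα _ le_rfl]
    congr 1
    exact Datum.ray_congr fun j _ => by rw [hγβ]
  have hγ : D.IsCode D.δ (y : M) γ := by
    refine ⟨fun i => ?_, fun i hi => ?_⟩
    · rcases le_or_gt i J with h | h
      · rw [hγα i h]; exact hr.I_subset (hα.1 i)
      · obtain ⟨l, rfl⟩ := Nat.exists_eq_add_of_le (show J + 1 ≤ i from h)
        rw [hγβ]; exact hr.I_subset (hβ.1 l)
    · rcases le_or_gt i J with h | h
      · rw [hγα i h, hpα i (by omega)]
        have h1 := hα.2 i hi
        rw [← Datum.point_congr (D := D) fun j _ => hαα j] at h1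
        refine Subset.trans ?_ (h1.trans (hr.U_subset _ (hα.1 i)))
        exact Metric.ball_subset_ball' (by linarith [hy i h])
      · obtain ⟨l, rfl⟩ := Nat.exists_eq_add_of_le (show J + 1 ≤ i from h)
        rw [hγβ, hpβ]
        refine Subset.trans (Metric.ball_subset_ball hr.δ_lt.le)
          (Subset.trans ?_ (hr.U_subset _ (hβ.1 l)))
        rcases Nat.eq_zero_or_pos l with rfl | hl
        · exact hβ0
        · rw [Datum.point_congr (D₀ := D₀) fun j _ => hββ j]
          exact hβ.2 l hl
  -- The spliced code need not be a `D₀`-code, so the definition of `π` does not apply to it. But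
  -- the tail of its ray is a translate of a `D₀`-ray, whose class is known by equivariance.
  have hrep : Represents S (D.ray γ) (π y) := by
    obtain ⟨ξ, hξ⟩ := H.exists_represents (X.biLip y y.2 _ X.meandering.expansion.δ_pos γ hγ)
    have h1 := (hπ ⟨_, hz⟩ _ ⟨β, hβ, rfl⟩).smul (D.ray α J)
    rw [← X.map_smul hπ] at h1
    have h2 : (⟨D.ray α J • D.point α (y : M) (J + 1), X.smul_mem _ _ hz⟩ : Λ) = y :=
      Subtype.ext (by simp only [D.point_succ, smul_inv_smul])
    rw [h2] at h1
    have h3 := H.eq_of_represents_of_frequently ((X.biLip₀ hz hβ).mul_left (D.ray α J)) h1 hξ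
      (k := 0) (Eventually.of_forall fun j => ⟨J + 1 + j, by
        rw [hrβ, hβray, SimpleGraph.dist_self]⟩).frequently
    rwa [h3]
  obtain ⟨j, hj⟩ := (near x α hαD (hαray ▸ hπ x _ ⟨α, hα, rfl⟩) c hc0 hc).1 m
  have hbl := X.biLip x x.2 _ X.meandering.expansion.δ_pos α hαD
  have hjJ : j ≤ J := by
    have h1 := (hbl 0 j).2
    rw [Nat.zero_add] at h1
    have h2 : (cayley S).dist (D.ray α 0) 1 ≤ E := hE ⟨α 0, hαD.1 0, rfl⟩
    have h3 := (H.isRay c).dist_zero m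
    have h4 := hd.triangle (D.ray α 0) 1 (D.ray α j)
    have h5 := hd.triangle 1 (c.1 m) (D.ray α j)
    rw [hc0] at h3
    rw [hJ]
    exact h1.trans (Nat.mul_le_mul_left A (by omega))
  obtain ⟨i, hi⟩ := (near y γ hγ hrep c' hc'0 hc').2 j
  rw [hrα j hjJ] at hi
  -- Both rays are within `K` of `D.ray α j`; passing to equal times doubles `2 K`.
  have h1 := (H.isRay c).dist_comp_le hd (H.isRay c') (i := m) (j := i)
  rw [hc0, hc'0, hd.self] at h1
  have h2 := hd.triangle (c.1 m) (D.ray α j) (c'.1 i)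
  have h3 := hd.comm (c'.1 i) (D.ray α j)
  omega

end MeanderingSetup

end Coding

/-! ### Topological properties of the coding map -/

/-- A finite substitute for the Baire theorem, valid in every nonempty space. -/
theorem _root_.Set.Finite.exists_nonempty_interior_of_biUnion {Y κ : Type*} [TopologicalSpace Y]
    [Nonempty Y] {t : Set κ} (ht : t.Finite) {f : κ → Set Y} (hf : ∀ i ∈ t, IsClosed (f i))
    (hcov : ⋃ i ∈ t, f i = univ) : ∃ i ∈ t, (interior (f i)).Nonempty := by
  by_contra! hcon
  have key : interior (⋃ i ∈ t, f i) = ∅ := by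
    clear hcov
    induction t, ht using Set.Finite.induction_on with
    | empty => simp
    | @insert i t _ ht ih =>
      rw [biUnion_insert]
      rw [interior_union_isClosed_of_interior_empty (hf i (mem_insert _ _))]
      · exact hcon i (mem_insert _ _)
      · exact ih (fun j hj => hf j (mem_insert_of_mem _ hj))
          fun j hj => hcon j (mem_insert_of_mem _ hj)
  rw [hcov, interior_univ] at key
  exact univ_nonempty.ne_empty key

section CodingTopology

variable {Γ M ι : Type*} [Group Γ] [MetricSpace M] [MulAction Γ M] [ContinuousConstSMul Γ M]
  {S : Set Γ} {Λ : Set M} {D₀ D : Datum Γ M ι} {N δ A : ℕ}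

/-- An open subset of a minimal invariant set meets every orbit. -/
theorem IsMinimalInvariant.exists_smul_mem {K : Set M}
    (hK : IsMinimalInvariant Γ K) {V : Set K} (hV : IsOpen V) (hVne : V.Nonempty) (x : K) :
    ∃ g : Γ, ⟨g • (x : M), hK.1.2.2 g x x.2⟩ ∈ V := by
  by_contra! hcon
  obtain ⟨W, hW, rfl⟩ := isOpen_induced_iff.1 hV
  let C : Set M := K ∩ ⋂ g : Γ, (fun y => g • y) ⁻¹' Wᶜ
  have hC : C.Nonempty ∧ IsClosed C ∧ ∀ g : Γ, ∀ y ∈ C, g • y ∈ C := by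
    refine ⟨⟨x, x.2, mem_iInter.2 hcon⟩, hK.1.2.1.inter (isClosed_iInter fun g =>
      hW.isClosed_compl.preimage (continuous_const_smul g)), fun g y hy => ?_⟩
    refine ⟨hK.1.2.2 g y hy.1, mem_iInter.2 fun h => ?_⟩
    have := mem_iInter.1 hy.2 (h * g)
    simpa only [mem_preimage, mul_smul] using this
  obtain ⟨v, hv⟩ := hVne
  have := mem_iInter.1 (hK.2 hC inter_subset_left v.2).2 1
  simp only [mem_preimage, one_smul] at this
  exact this hv

namespace MeanderingSetup

variable (X : MeanderingSetup S Λ D₀ D N δ A) {π : Λ → GromovBoundary S}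
  (hπ : IsCodingMap S Λ D₀ π)

include X hπ

theorem continuous_coding : Continuous π := by
  obtain ⟨k, hk⟩ := X.exists_forall_eventually_dist_le hπ
  refine continuous_def.2 fun U hU => isOpen_iff_mem_nhds.2 fun x hx => ?_
  obtain ⟨c, hc0, hc⟩ := X.hyp.exists_ray_from (π x) 1
  obtain ⟨n, hn⟩ := (hU c hc0 (hc ▸ hx) (k + 1)).exists
  filter_upwards [hk x c hc0 hc n] with y hy
  obtain ⟨c', hc'0, hc'⟩ := X.hyp.exists_ray_from (π y) 1
  refine hn (X.hyp.mem_shadow_iff.2 ⟨c', hc'0, hc', ?_⟩)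
  rw [SimpleGraph.dist_comm]
  exact Nat.lt_succ_of_le (hy c' hc'0 hc' n le_rfl)

/-- A compact set whose image meets the shadows of a ray arbitrarily far out contains a point that
is mapped to the endpoint of that ray. -/
theorem exists_eq_endpoint_of_frequently {K : Set Λ} (hK : IsCompact K) {c₀ : GeodesicRay S}
    (h0 : c₀.1 0 = 1) {k : ℕ} (h : ∃ᶠ n in atTop, ∃ x ∈ K, π x ∈ shadow S k c₀ n) :
    ∃ x ∈ K, π x = c₀.endpoint := by
  obtain ⟨φ, hφ, hφ'⟩ := extraction_of_frequently_atTop h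
  choose u huK hu using hφ'
  obtain ⟨a, haK, ψ, hψ, hlim⟩ := hK.tendsto_subseq huK
  refine ⟨a, haK, ?_⟩
  obtain ⟨k', hk'⟩ := X.exists_forall_eventually_dist_le hπ
  obtain ⟨c, hc0, hc⟩ := X.hyp.exists_ray_from (π a) 1
  rw [← hc]
  -- For fixed `m` and large `j`, a ray to `π (u (ψ j))` is close at time `m` to `c`, by continuity,
  -- and to `c₀`, by the shadow.
  refine X.hyp.endpoint_eq_of_forall_dist_le (k := k' + (16 * δ + 3 * k)) fun m => ?_
  obtain ⟨j, h1, h2⟩ := ((hlim.eventually (hk' a c hc0 hc m)).and (eventually_ge_atTop m)).exists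
  obtain ⟨c', hc'0, hc'⟩ := X.hyp.exists_ray_from (π (u (ψ j))) 1
  have h3 : m ≤ φ (ψ j) := h2.trans ((hψ.id_le j).trans (hφ.id_le _))
  exact (X.hyp.metric.triangle _ (c'.1 m) _).trans (add_le_add (h1 c' hc'0 hc' m le_rfl)
    (X.hyp.dist_le_of_mem_shadow h0 hc'0 (hc' ▸ hu (ψ j)) h3))

/-- No separation property of the boundary is needed: if the complement is not open at an endpoint,
the image meets its shadows arbitrarily far out, and compactness puts the endpoint into the image.
-/
theorem isClosed_image {K : Set Λ} (hK : IsCompact K) : IsClosed (π '' K) := by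
  rw [← isOpen_compl_iff]
  intro c₀ h0 hc₀ k
  by_contra hcon
  obtain ⟨x, hx, hx'⟩ := X.exists_eq_endpoint_of_frequently hπ hK h0 (k := k)
    ((not_eventually.1 hcon).mono fun n hn => by
      obtain ⟨_, h1, h2⟩ := not_subset.1 hn
      obtain ⟨x, hx, rfl⟩ := not_not.1 h2
      exact ⟨x, hx, h1⟩)
  exact hc₀ ⟨x, hx, hx'⟩

theorem surjective_coding (hne : ¬ IsElementary Γ) {K : Set M} (hK : K ⊆ Λ) (hKc : IsCompact K)
    (hKne : K.Nonempty) (hKinv : ∀ g : Γ, ∀ x ∈ K, g • x ∈ K) :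
    Function.Surjective (π ∘ inclusion hK) := by
  intro ξ
  obtain ⟨a, b, hab⟩ := X.exists_coding_ne hπ hne hK hKne hKinv
  obtain ⟨r, hr0, rfl⟩ := X.hyp.exists_ray_from ξ 1
  obtain ⟨k, hk⟩ := X.hyp.exists_smul_mem_shadow hab
  have hKc' : IsCompact ((↑) ⁻¹' K : Set Λ) := by
    rwa [Subtype.isCompact_iff, Subtype.image_preimage_coe, inter_eq_self_of_subset_right hK]
  obtain ⟨x, hx, hx'⟩ := X.exists_eq_endpoint_of_frequently hπ hKc' hr0 (k := k)
    (Eventually.of_forall fun n => by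
      rcases hk r hr0 n with h | h
      · exact ⟨⟨r.1 n • (a : M), hK (hKinv _ a a.2)⟩, hKinv _ a a.2,
          (X.map_smul hπ (r.1 n) (inclusion hK a)).symm ▸ h⟩
      · exact ⟨⟨r.1 n • (b : M), hK (hKinv _ b b.2)⟩, hKinv _ b b.2,
          (X.map_smul hπ (r.1 n) (inclusion hK b)).symm ▸ h⟩).frequently
  exact ⟨⟨x, hx⟩, hx'⟩

theorem isQuasiOpen_coding (hne : ¬ IsElementary Γ) {K : Set M} (hK : K ⊆ Λ)
    (hKc : IsCompact K) (hmin : IsMinimalInvariant Γ K) : IsQuasiOpen (π ∘ inclusion hK) := by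
  intro V ⟨v, hv⟩
  have : CompactSpace K := isCompact_iff_compactSpace.1 hKc
  have hsurj := X.surjective_coding hπ hne hK hKc hmin.1.1 hmin.1.2.2
  -- a compact neighbourhood inside `V`
  obtain ⟨C, hC, hCV, hCc⟩ := local_compact_nhds (mem_interior_iff_mem_nhds.1 hv)
  have hCne : (interior C).Nonempty := ⟨v, mem_interior_iff_mem_nhds.2 hC⟩
  let T : Γ → K → K := fun g x => ⟨g • (x : M), hmin.1.2.2 g x x.2⟩
  have hT : ∀ g, Continuous (T g) := fun g =>
    ((continuous_const_smul g).comp continuous_subtype_val).subtype_mk _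
  have hcov : (univ : Set K) ⊆ ⋃ g : Γ, T g ⁻¹' interior C := fun x _ =>
    mem_iUnion.2 (hmin.exists_smul_mem isOpen_interior hCne x)
  obtain ⟨t, ht⟩ := isCompact_univ.elim_finite_subcover _
    (fun g => isOpen_interior.preimage (hT g)) hcov
  have hclosed : IsClosed ((π ∘ inclusion hK) '' C) := by
    rw [image_comp]
    exact X.isClosed_image hπ (hCc.image (continuous_inclusion hK))
  have hne' : Nonempty (GromovBoundary S) := ⟨(π ∘ inclusion hK) v⟩
  -- By surjectivity and equivariance, the finite cover of `K` by translates of `C` becomes a finite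
  -- closed cover of the boundary by translates of the image of `C`.
  obtain ⟨g, -, hg⟩ := t.finite_toSet.exists_nonempty_interior_of_biUnion
    (f := fun g => (fun ξ : GromovBoundary S => g • ξ) ⁻¹' ((π ∘ inclusion hK) '' C))
    (fun g _ => hclosed.preimage (X.hyp.continuous_smul g)) (by
      refine eq_univ_of_forall fun ξ => ?_
      obtain ⟨x, rfl⟩ := hsurj ξ
      obtain ⟨g, hg, hx⟩ := mem_iUnion₂.1 (ht (mem_univ x))
      refine mem_iUnion₂.2 ⟨g, hg, T g x, interior_subset hx, ?_⟩
      exact X.map_smul hπ g (inclusion hK x))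
  refine Nonempty.mono (interior_mono (image_mono hCV)) ?_
  obtain ⟨ξ, hξ⟩ := hg
  refine ⟨g • ξ, mem_interior.2 ⟨(fun ζ : GromovBoundary S => g⁻¹ • ζ) ⁻¹' interior
    ((fun ξ : GromovBoundary S => g • ξ) ⁻¹' ((π ∘ inclusion hK) '' C)), fun ζ hζ => ?_,
    isOpen_interior.preimage (X.hyp.continuous_smul g⁻¹), ?_⟩⟩
  · have := interior_subset hζ
    rwa [mem_preimage, smul_inv_smul] at this
  · rwa [mem_preimage, inv_smul_smul]

theorem perfectSpace_of_isMinimalInvariant (hne : ¬ IsElementary Γ) {K : Set M} (hK : K ⊆ Λ)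
    (hKc : IsCompact K) (hmin : IsMinimalInvariant Γ K) : PerfectSpace K := by
  rw [perfectSpace_iff_forall_not_isolated]
  intro x
  by_contra hx
  have : CompactSpace K := isCompact_iff_compactSpace.1 hKc
  have hopen : IsOpen ({x} : Set K) := isOpen_singleton_iff_punctured_nhds x |>.2 (not_neBot.1 hx)
  let T : Γ → K → K := fun g x => ⟨g • (x : M), hmin.1.2.2 g x x.2⟩
  have hT : ∀ g, Continuous (T g) := fun g =>
    ((continuous_const_smul g).comp continuous_subtype_val).subtype_mk _
  have hinj : ∀ g, Function.Injective (T g) := fun g y z h =>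
    Subtype.ext (smul_left_cancel g (congrArg Subtype.val h))
  -- every point of `K` is isolated
  have hdisc : DiscreteTopology K := by
    refine discreteTopology_iff_isOpen_singleton.2 fun y => ?_
    obtain ⟨g, hg⟩ := hmin.exists_smul_mem hopen (singleton_nonempty x) y
    have hy : T g ⁻¹' {x} = {y} := by
      ext z
      rw [mem_preimage, mem_singleton_iff, mem_singleton_iff, ← mem_singleton_iff.1 hg]
      exact (hinj g).eq_iff
    exact hy ▸ hopen.preimage (hT g)
  -- A finite `K` maps onto the boundary, so orbits there are finite and stabilizers have finite
  -- index.
  have hfin : Finite K := finite_of_compact_of_discrete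
  have hbdry : Finite (GromovBoundary S) :=
    Finite.of_surjective _ (X.surjective_coding hπ hne hK hKc hmin.1.1 hmin.1.2.2)
  have : (MulAction.stabilizer Γ (π (inclusion hK x))).FiniteIndex := by
    have : Finite (Γ ⧸ MulAction.stabilizer Γ (π (inclusion hK x))) :=
      Finite.of_equiv _ (MulAction.orbitEquivQuotientStabilizer Γ (π (inclusion hK x)))
    exact Subgroup.finiteIndex_of_finite_quotient
  exact hne (X.hyp.isElementary_of_finiteIndex_stabilizer (π (inclusion hK x)))

end MeanderingSetup

end CodingTopology

end MeanderingHyperbolic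

theorem theorem6p7 {Γ M ι : Type*} [Group Γ] [MetricSpace M] [ProperSpace M]
    [MulAction Γ M] [ContinuousConstSMul Γ M]
    (hΓ : IsHyperbolicGroup Γ) (hne : ¬ IsElementary Γ)
    -- the finite generating set whose Cayley graph is used for the Gromov boundary
    (S : Set Γ) (hSfin : S.Finite) (hSgen : Subgroup.closure S = ⊤)
    (Λ : Set M) (hΛ : Λ.Nonempty) (hΛc : IsCompact Λ)
    (hΛinv : ∀ g : Γ, ∀ x ∈ Λ, g • x ∈ Λ)
    (hΛiso : ∀ x ∈ Λ, (𝓝[≠] x).NeBot)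
    (D₀ D : Datum Γ M ι) (N : ℕ) (hD : IsMeanderingDatum Λ D₀ D N) :
    ∃ π : Λ → GromovBoundary S,
      -- the coding map is well defined
      IsCodingMap S Λ D₀ π ∧ (∀ π', IsCodingMap S Λ D₀ π' → π' = π) ∧
      (∀ (g : Γ) (x : Λ), π ⟨g • (x : M), hΛinv g x x.2⟩ = g • π x) ∧
      Continuous π ∧ Function.Surjective π ∧
      ∀ (K : Set M) (hK : K ⊆ Λ), IsMinimalInvariant Γ K →
        Function.Surjective (π ∘ Set.inclusion hK) ∧
        IsQuasiOpen (π ∘ Set.inclusion hK) ∧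
        PerfectSpace K ∧ Nontrivial K := by
  obtain ⟨δ, hδ⟩ := hΓ.exists_isHyperbolicCayley hSfin hSgen
  obtain ⟨A, hA⟩ := hD.expansion.exists_biLip_cayley hΛinv hΛiso hSfin hSgen
  have X : MeanderingSetup S Λ D₀ D N δ A := ⟨hδ, hSgen, hΛinv, hD, hA⟩
  obtain ⟨π, hπ⟩ := X.exists_isCodingMap
  refine ⟨π, hπ, fun π' hπ' => X.isCodingMap_unique hπ hπ', X.map_smul hπ,
    X.continuous_coding hπ, X.surjective_coding hπ hne Subset.rfl hΛc hΛ hΛinv,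
    fun K hK hmin => ?_⟩
  have hKc : IsCompact K := hΛc.of_isClosed_subset hmin.1.2.1 hK
  refine ⟨X.surjective_coding hπ hne hK hKc hmin.1.1 hmin.1.2.2,
    X.isQuasiOpen_coding hπ hne hK hKc hmin,
    X.perfectSpace_of_isMinimalInvariant hπ hne hK hKc hmin, ?_⟩
  obtain ⟨x, y, hxy⟩ := X.exists_coding_ne hπ hne hK hmin.1.1 hmin.1.2.2
  exact ⟨x, y, fun h => hxy (h ▸ rfl)⟩
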